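/- All manifolds are smooth, finite-dimensional, Hausdorff and without boundary, all Riemannian metrics are smooth, and a Riemannian metric $g$ has \emph{positive Ricci curvature} if $\mathrm{Ric}_g(v,v)>0$ for every nonzero tangent vector $v$. Let $G$ be a Lie group acting smoothly on a manifold $F$, and let $\pi:M\to B$ be a smooth fiber bundle with fiber $F$ and structure group $G$. That is, $M$ and $B$ are manifolds, and there are an open cover $(U_i)_{i\in I}$ of $B$, diffeomorphisms $\varphi_i:\pi^{-1}(U_i)\to U_i\times F$ whose first component is $\pi$, and smooth maps $\tau_{ij}:U_i\cap U_j\to G$ such that $\varphi_j\circ\varphi_i^{-1}(b,f)=(b,\tau_{ij}(b)\cdot f)$ for $b\in U_i\cap U_j$, $f\in F$, and $\tau_{jk}(b)\,\tau_{ij}(b)=\tau_{ik}(b)$ for $b\in U_i\cap U_j\cap U_k$. Suppose that the total space $M$ is compact and connected, and that 1. $B$ admits a Riemannian metric of positive Ricci curvature; 2. $F$ admits a $G$-invariant Riemannian metric of positive Ricci curvature. Then $M$ admits a Riemannian metric of positive Ricci curvature. -/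

import Mathlib

open scoped Manifold ContDiff

noncomputable section

set_option maxSynthPendingDepth 3

namespace PosRicci

/-! ### Ricci curvature of a metric on a vector space, in linear coordinates -/

section Coordinates

variable {E : Type*} [NormedAddCommGroup E] [NormedSpace ℝ E]

/-- Christoffel symbols of the first kind of the metric `G` at `y`:
`(v, w, z) ↦ ½ (∂_v G(w, z) + ∂_w G(v, z) - ∂_z G(v, w))`. -/
def koszulForm (G : E → E →L[ℝ] E →L[ℝ] ℝ) (y : E) : E →L[ℝ] E →L[ℝ] E →L[ℝ] ℝ :=
  let D : E →L[ℝ] E →L[ℝ] E →L[ℝ] ℝ := fderiv ℝ G y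
  let D' : E →L[ℝ] E →L[ℝ] E →L[ℝ] ℝ :=
    (ContinuousLinearMap.flipₗᵢ ℝ E E ℝ).toContinuousLinearEquiv.toContinuousLinearMap ∘L D.flip
  (1 / 2 : ℝ) • (D + D.flip - D')

theorem koszulForm_apply (G : E → E →L[ℝ] E →L[ℝ] ℝ) (y v w z : E) :
    koszulForm G y v w z =
      (1 / 2) * (fderiv ℝ G y v w z + fderiv ℝ G y w v z - fderiv ℝ G y z v w) := by
  simp [koszulForm]

/-- Christoffel symbols of the second kind: `Γ_y(v, w)` is the vector representing the functional
`koszulForm G y v w` with respect to `G y`, i.e. the Levi-Civita derivative `∇_v w` of the constant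
vector field `w`. -/
def christoffel (G : E → E →L[ℝ] E →L[ℝ] ℝ) (y : E) : E →L[ℝ] E →L[ℝ] E :=
  (ContinuousLinearMap.compL ℝ E (E →L[ℝ] ℝ) E (G y).inverse) ∘L koszulForm G y

theorem christoffel_apply (G : E → E →L[ℝ] E →L[ℝ] ℝ) (y v w : E) :
    christoffel G y v w = (G y).inverse (koszulForm G y v w) := rfl

/-- The endomorphism `u ↦ R(u, v) w`, where `R(u, v) w = ∇_u ∇_v w - ∇_v ∇_u w` for constant
vector fields `u`, `v`, `w`. -/
def curvatureEndo (G : E → E →L[ℝ] E →L[ℝ] ℝ) (y v w : E) : E →L[ℝ] E :=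
  ((fderiv ℝ (christoffel G) y).flip v).flip w - (fderiv ℝ (christoffel G) y v).flip w
    + (christoffel G y).flip (christoffel G y v w)
    - christoffel G y v ∘L (christoffel G y).flip w

theorem curvatureEndo_apply (G : E → E →L[ℝ] E →L[ℝ] ℝ) (y u v w : E) :
    curvatureEndo G y v w u =
      fderiv ℝ (christoffel G) y u v w - fderiv ℝ (christoffel G) y v u w
        + christoffel G y u (christoffel G y v w) - christoffel G y v (christoffel G y u w) := by
  simp [curvatureEndo]

/-- The Ricci tensor `Ric(v, w) = tr (u ↦ R(u, v) w)` of the metric `G` at `y`. -/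
def coordRicci (G : E → E →L[ℝ] E →L[ℝ] ℝ) (y v w : E) : ℝ :=
  LinearMap.trace ℝ E (curvatureEndo G y v w).toLinearMap

end Coordinates

/-! ### Riemannian metrics and positive Ricci curvature on manifolds -/

section Manifold

/-- Smooth Riemannian metrics on a manifold `M` without boundary modelled on `E`. -/
abbrev RiemMetric (E : Type*) [NormedAddCommGroup E] [NormedSpace ℝ E]
    (M : Type*) [TopologicalSpace M] [ChartedSpace E M] [IsManifold 𝓘(ℝ, E) ∞ M] :=
  Bundle.ContMDiffRiemannianMetric 𝓘(ℝ, E) ∞ E (fun x : M ↦ TangentSpace 𝓘(ℝ, E) x)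

variable {E : Type*} [NormedAddCommGroup E] [NormedSpace ℝ E]
  {M : Type*} [TopologicalSpace M] [ChartedSpace E M] [IsManifold 𝓘(ℝ, E) ∞ M]

/-- The metric `g` read in the preferred chart around `p`, i.e. its pullback under the inverse of
the chart. -/
def chartMetric (g : RiemMetric E M) (p : M) (y : E) : E →L[ℝ] E →L[ℝ] ℝ :=
  let A : E →L[ℝ] E := mfderiv 𝓘(ℝ, E) 𝓘(ℝ, E) (extChartAt 𝓘(ℝ, E) p).symm y
  let b : E →L[ℝ] E →L[ℝ] ℝ := g.inner ((extChartAt 𝓘(ℝ, E) p).symm y)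
  b.bilinearComp A A

theorem chartMetric_apply (g : RiemMetric E M) (p : M) (y v w : E) :
    chartMetric g p y v w = g.inner ((extChartAt 𝓘(ℝ, E) p).symm y)
      (mfderiv 𝓘(ℝ, E) 𝓘(ℝ, E) (extChartAt 𝓘(ℝ, E) p).symm y v)
      (mfderiv 𝓘(ℝ, E) 𝓘(ℝ, E) (extChartAt 𝓘(ℝ, E) p).symm y w) := rfl

/-- The Ricci tensor of `g` at `p`, computed in the preferred chart around `p`. -/
def ricci (g : RiemMetric E M) (p : M) (v w : TangentSpace 𝓘(ℝ, E) p) : ℝ :=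
  coordRicci (chartMetric g p) (extChartAt 𝓘(ℝ, E) p p)
    (mfderiv 𝓘(ℝ, E) 𝓘(ℝ, E) (extChartAt 𝓘(ℝ, E) p) p v)
    (mfderiv 𝓘(ℝ, E) 𝓘(ℝ, E) (extChartAt 𝓘(ℝ, E) p) p w)

/-- `g` has positive Ricci curvature. -/
def HasPositiveRicci (g : RiemMetric E M) : Prop :=
  ∀ (p : M) (v : TangentSpace 𝓘(ℝ, E) p), v ≠ 0 → 0 < ricci g p v v

/-- `g` is invariant under the action of `G`: every element of `G` acts by an isometry. -/
def IsInvariantMetric (G : Type*) [SMul G M] (g : RiemMetric E M) : Prop :=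
  ∀ (a : G) (x : M) (v w : TangentSpace 𝓘(ℝ, E) x),
    g.inner (a • x) (mfderiv 𝓘(ℝ, E) 𝓘(ℝ, E) (fun y : M ↦ a • y) x v)
      (mfderiv 𝓘(ℝ, E) 𝓘(ℝ, E) (fun y : M ↦ a • y) x w) = g.inner x v w

end Manifold

/-! ### Smooth fibre bundles with structure group -/

/-- The structure on `π : M → B` of a smooth fibre bundle with fibre `F` and structure group `G`:
smooth local trivializations over an open cover of `B`, whose transition maps are given by a
smooth cocycle with values in `G`, acting on `F`. -/
structure FiberBundleWithGroup (EM EB EF EG : Type*)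
    [NormedAddCommGroup EM] [NormedSpace ℝ EM] [NormedAddCommGroup EB] [NormedSpace ℝ EB]
    [NormedAddCommGroup EF] [NormedSpace ℝ EF] [NormedAddCommGroup EG] [NormedSpace ℝ EG]
    {M B : Type*} (F G : Type*)
    [TopologicalSpace M] [ChartedSpace EM M] [TopologicalSpace B] [ChartedSpace EB B]
    [TopologicalSpace F] [ChartedSpace EF F] [TopologicalSpace G] [ChartedSpace EG G]
    [Group G] [MulAction G F] (ι : Type*) (π : M → B) where
  /-- the local trivializations -/
  triv : ι → Bundle.Trivialization F π
  /-- the transition functions -/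
  transition : ι → ι → B → G
  cover : ∀ b : B, ∃ i, b ∈ (triv i).baseSet
  contMDiffOn_triv : ∀ i, ContMDiffOn 𝓘(ℝ, EM) (𝓘(ℝ, EB).prod 𝓘(ℝ, EF)) ∞
    (triv i) (triv i).source
  contMDiffOn_triv_symm : ∀ i, ContMDiffOn (𝓘(ℝ, EB).prod 𝓘(ℝ, EF)) 𝓘(ℝ, EM) ∞
    (triv i).toOpenPartialHomeomorph.symm (triv i).target
  contMDiffOn_transition : ∀ i j, ContMDiffOn 𝓘(ℝ, EB) 𝓘(ℝ, EG) ∞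
    (transition i j) ((triv i).baseSet ∩ (triv j).baseSet)
  coordChange_eq : ∀ i j, ∀ b ∈ (triv i).baseSet ∩ (triv j).baseSet, ∀ f : F,
    (triv i).coordChange (triv j) b f = transition i j b • f
  cocycle : ∀ i j k, ∀ b ∈ (triv i).baseSet ∩ (triv j).baseSet ∩ (triv k).baseSet,
    transition j k b * transition i j b = transition i k b

end PosRicci

end

/-!
Averaging the flat connections of the local trivializations by a partition of unity on `B` gives a
connection on `M`. As the structure group acts on `F` by isometries, the connection form is, in
each trivialization, a one-form on the base with values in the Killing fields of `F`. Let `g s` be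
the metric for which the horizontal and vertical spaces are orthogonal, `π` is a Riemannian
submersion, and the fibers carry the metric of `F` scaled by `s`. In coordinates, the Christoffel
symbols of `g s` are exactly affine in `s`, of the form `Γ₀ + s Γ₁`, so they extend smoothly to
`s = 0` although `g s` degenerates there. The limit connection `Γ₀` makes the projection to `B` an
affine map and the fibers totally geodesic. Since Killing fields are infinitesimal affine maps, the
Ricci tensor of `Γ₀` is the sum of the Ricci tensors of `B` and of the fiber, evaluated at the
horizontal and vertical parts, and so it is positive definite. By continuity the Ricci tensor of
`g s` is positive definite near each point of `M` for small `s > 0`, and by compactness of `M` a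
single `s` works everywhere.
-/

noncomputable section

set_option maxSynthPendingDepth 3

namespace PosRicci

open Filter Topology

/-! ### Affine maps, isometries and Killing fields in coordinates -/

section Calculus

variable {D E E' F : Type*} [NormedAddCommGroup D] [NormedSpace ℝ D]
  [NormedAddCommGroup E] [NormedSpace ℝ E] [NormedAddCommGroup E'] [NormedSpace ℝ E']
  [NormedAddCommGroup F] [NormedSpace ℝ F] {x : D}

theorem contDiffAt_clm_of_apply [FiniteDimensional ℝ E] {n : WithTop ℕ∞} {f : D → E →L[ℝ] F}
    (h : ∀ v, ContDiffAt ℝ n (fun z ↦ f z v) x) : ContDiffAt ℝ n f x := by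
  let d := Module.finrank ℝ E
  have hd : d = Module.finrank ℝ (Fin d → ℝ) := (Module.finrank_fin_fun ℝ).symm
  let e₁ := ContinuousLinearEquiv.ofFinrankEq hd
  let e₂ := (e₁.arrowCongr (1 : F ≃L[ℝ] F)).trans (ContinuousLinearEquiv.piRing (Fin d))
  rw [← Function.id_comp f, ← e₂.symm_comp_self]
  exact e₂.symm.contDiff.contDiffAt.comp x (contDiffAt_pi.mpr fun i ↦ h _)

theorem contDiffAt_bilin_of_apply [FiniteDimensional ℝ E] [FiniteDimensional ℝ E']
    {n : WithTop ℕ∞} {f : D → E →L[ℝ] E' →L[ℝ] F}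
    (h : ∀ v w, ContDiffAt ℝ n (fun z ↦ f z v w) x) : ContDiffAt ℝ n f x :=
  contDiffAt_clm_of_apply fun v ↦ contDiffAt_clm_of_apply fun w ↦ h v w

theorem fderiv_clm_apply_apply {A : D → E →L[ℝ] F} {a : D → E} (hA : DifferentiableAt ℝ A x)
    (ha : DifferentiableAt ℝ a x) (u : D) :
    fderiv ℝ (fun z ↦ A z (a z)) x u = fderiv ℝ A x u (a x) + A x (fderiv ℝ a x u) := by
  simp [fderiv_clm_apply hA ha, add_comm]

theorem fderiv_clm_apply_const {A : D → E →L[ℝ] F} (hA : DifferentiableAt ℝ A x) (u : D) (v : E) :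
    fderiv ℝ (fun z ↦ A z v) x u = fderiv ℝ A x u v := by
  simp [fderiv_clm_apply_apply hA (differentiableAt_const v)]

theorem fderiv_bilin_apply_apply {A : D → E →L[ℝ] E' →L[ℝ] F} {a : D → E} {b : D → E'}
    (hA : DifferentiableAt ℝ A x) (ha : DifferentiableAt ℝ a x) (hb : DifferentiableAt ℝ b x)
    (u : D) :
    fderiv ℝ (fun z ↦ A z (a z) (b z)) x u = fderiv ℝ A x u (a x) (b x) +
      A x (fderiv ℝ a x u) (b x) + A x (a x) (fderiv ℝ b x u) := by
  rw [fderiv_clm_apply_apply (hA.clm_apply ha) hb, fderiv_clm_apply_apply hA ha, add_apply]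

theorem fderiv_bilin_apply_const {A : D → E →L[ℝ] E' →L[ℝ] F} (hA : DifferentiableAt ℝ A x)
    (u : D) (v : E) (w : E') :
    fderiv ℝ (fun z ↦ A z v w) x u = fderiv ℝ A x u v w := by
  simp [fderiv_bilin_apply_apply hA (differentiableAt_const v) (differentiableAt_const w)]

theorem eventually_isInvertible_fderiv [CompleteSpace E] {φ : E → E'} {y : E}
    (hφ : ContDiffAt ℝ 1 φ y) (h : (fderiv ℝ φ y).IsInvertible) :
    ∀ᶠ z in 𝓝 y, (fderiv ℝ φ z).IsInvertible := by
  obtain ⟨L, hL⟩ := h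
  have hc : ContinuousAt (fderiv ℝ φ) y := (hφ.fderiv_right (m := 0) (by simp)).continuousAt
  exact hc.eventually_mem (hL ▸ ContinuousLinearEquiv.nhds L)

end Calculus

section Connection

variable {E E' : Type*} [NormedAddCommGroup E] [NormedSpace ℝ E]
  [NormedAddCommGroup E'] [NormedSpace ℝ E']

/-- The endomorphism `u ↦ R(u, v) w` of the linear connection with Christoffel symbols `Γ`. -/
def connCurv (Γ : E → E →L[ℝ] E →L[ℝ] E) (y v w : E) : E →L[ℝ] E :=
  ((fderiv ℝ Γ y).flip v).flip w - (fderiv ℝ Γ y v).flip w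
    + (Γ y).flip (Γ y v w) - Γ y v ∘L (Γ y).flip w

theorem connCurv_apply (Γ : E → E →L[ℝ] E →L[ℝ] E) (y u v w : E) :
    connCurv Γ y v w u = fderiv ℝ Γ y u v w - fderiv ℝ Γ y v u w
        + Γ y u (Γ y v w) - Γ y v (Γ y u w) := by
  simp [connCurv]

/-- The Ricci tensor of the linear connection with Christoffel symbols `Γ`. -/
def connRicci (Γ : E → E →L[ℝ] E →L[ℝ] E) (y v w : E) : ℝ :=
  LinearMap.trace ℝ E (connCurv Γ y v w).toLinearMap

theorem coordRicci_eq_connRicci (G : E → E →L[ℝ] E →L[ℝ] ℝ) (y v w : E) :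
    coordRicci G y v w = connRicci (christoffel G) y v w := rfl

theorem connRicci_smul (Γ : E → E →L[ℝ] E →L[ℝ] E) (c : ℝ) (y v : E) :
    connRicci Γ y (c • v) (c • v) = c ^ 2 * connRicci Γ y v v := by
  have hcurv : connCurv Γ y (c • v) (c • v) = c ^ 2 • connCurv Γ y v v := by
    ext u
    simp only [connCurv_apply, map_smul, smul_apply, smul_sub, smul_add, smul_smul, pow_two]
  rw [connRicci, hcurv, ContinuousLinearMap.toLinearMap_smul, map_smul, smul_eq_mul, connRicci]

/-- `φ` is an affine map near `y`: it carries the connection with Christoffel symbols `Γ` to the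
one with Christoffel symbols `Γ'`. -/
def IsAffineAt (φ : E → E') (Γ : E → E →L[ℝ] E →L[ℝ] E) (Γ' : E' → E' →L[ℝ] E' →L[ℝ] E')
    (y : E) : Prop :=
  ∀ᶠ z in 𝓝 y, ∀ v w, fderiv ℝ φ z (Γ z v w) =
    fderiv ℝ (fderiv ℝ φ) z v w + Γ' (φ z) (fderiv ℝ φ z v) (fderiv ℝ φ z w)

namespace IsAffineAt

variable {φ : E → E'} {Γ : E → E →L[ℝ] E →L[ℝ] E} {Γ' : E' → E' →L[ℝ] E' →L[ℝ] E'} {y : E}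

theorem fderiv_eq (h : IsAffineAt φ Γ Γ' y) (hφ : ContDiffAt ℝ 3 φ y)
    (hΓ : DifferentiableAt ℝ Γ y) (hΓ' : DifferentiableAt ℝ Γ' (φ y)) (u v w : E) :
    fderiv ℝ (fderiv ℝ φ) y u (Γ y v w) + fderiv ℝ φ y (fderiv ℝ Γ y u v w) =
      fderiv ℝ (fderiv ℝ (fderiv ℝ φ)) y u v w
        + (fderiv ℝ Γ' (φ y) (fderiv ℝ φ y u) (fderiv ℝ φ y v) (fderiv ℝ φ y w)
        + Γ' (φ y) (fderiv ℝ (fderiv ℝ φ) y u v) (fderiv ℝ φ y w)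
        + Γ' (φ y) (fderiv ℝ φ y v) (fderiv ℝ (fderiv ℝ φ) y u w)) := by
  have hφ₁ : ContDiffAt ℝ 2 (fderiv ℝ φ) y := hφ.fderiv_right (by norm_num)
  have d₀ : DifferentiableAt ℝ φ y := hφ.differentiableAt (by norm_num)
  have d₁ : DifferentiableAt ℝ (fderiv ℝ φ) y := hφ₁.differentiableAt (by norm_num)
  have d₂ : DifferentiableAt ℝ (fderiv ℝ (fderiv ℝ φ)) y :=
    (hφ₁.fderiv_right (m := 1) (by norm_num)).differentiableAt (by norm_num)
  have dΓ' : DifferentiableAt ℝ (fun z ↦ Γ' (φ z)) y := hΓ'.comp y d₀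
  have d₁' (x : E) : DifferentiableAt ℝ (fun z ↦ fderiv ℝ φ z x) y :=
    d₁.clm_apply (differentiableAt_const x)
  have key := DFunLike.congr_fun (EventuallyEq.fderiv_eq (𝕜 := ℝ) (h.mono fun z hz ↦ hz v w)) u
  rwa [fderiv_clm_apply_apply d₁ (by fun_prop), fderiv_bilin_apply_const hΓ,
    fderiv_fun_add (by fun_prop) (by fun_prop), add_apply, fderiv_bilin_apply_const d₂,
    fderiv_bilin_apply_apply dΓ' (d₁' v) (d₁' w), fderiv_clm_apply_const d₁,
    fderiv_clm_apply_const d₁, fderiv_fun_comp _ hΓ' d₀, ContinuousLinearMap.comp_apply] at key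

theorem connCurv_eq (h : IsAffineAt φ Γ Γ' y) (hφ : ContDiffAt ℝ 3 φ y)
    (hΓ : DifferentiableAt ℝ Γ y) (hΓ' : DifferentiableAt ℝ Γ' (φ y)) (u v w : E) :
    fderiv ℝ φ y (connCurv Γ y v w u) =
      connCurv Γ' (φ y) (fderiv ℝ φ y v) (fderiv ℝ φ y w) (fderiv ℝ φ y u) := by
  have hφ₁ : ContDiffAt ℝ 2 (fderiv ℝ φ) y := hφ.fderiv_right (by norm_num)
  have symm₁ := (hφ.of_le (m := 2) (by norm_num)).isSymmSndFDerivAt (by simp)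
  have symm₂ := hφ₁.isSymmSndFDerivAt (by simp)
  have huv := eq_sub_of_add_eq' (h.fderiv_eq hφ hΓ hΓ' u v w)
  have hvu := eq_sub_of_add_eq' (h.fderiv_eq hφ hΓ hΓ' v u w)
  rw [symm₂.eq v u, symm₁.eq v u] at hvu
  simp only [connCurv_apply, map_add, map_sub, h.self_of_nhds, huv, hvu]
  abel

theorem connRicci_eq (h : IsAffineAt φ Γ Γ' y) (hφ : ContDiffAt ℝ 3 φ y)
    (hφi : (fderiv ℝ φ y).IsInvertible) (hΓ : DifferentiableAt ℝ Γ y)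
    (hΓ' : DifferentiableAt ℝ Γ' (φ y)) (v w : E) :
    connRicci Γ y v w = connRicci Γ' (φ y) (fderiv ℝ φ y v) (fderiv ℝ φ y w) := by
  obtain ⟨L, hL⟩ := hφi
  have hcurv (u : E) := h.connCurv_eq hφ hΓ hΓ' u v w
  simp only [← hL] at hcurv
  rw [connRicci, connRicci, ← LinearMap.trace_conj' _ L.toLinearEquiv, ← hL]
  congr 1
  ext x
  obtain ⟨u, rfl⟩ := L.surjective x
  simpa [LinearEquiv.conj_apply] using hcurv u

end IsAffineAt

theorem continuousAt_connRicci [FiniteDimensional ℝ E] {A : Type*} [TopologicalSpace A]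
    {Γ : A → E → E →L[ℝ] E →L[ℝ] E} {y v w : A → E} {a : A}
    (hΓ : ContinuousAt (fun x ↦ Γ x (y x)) a)
    (hΓ' : ContinuousAt (fun x ↦ fderiv ℝ (Γ x) (y x)) a)
    (hv : ContinuousAt v a) (hw : ContinuousAt w a) :
    ContinuousAt (fun x ↦ connRicci (Γ x) (y x) (v x) (w x)) a := by
  have htrace : Continuous fun T : E →L[ℝ] E ↦ LinearMap.trace ℝ E T.toLinearMap :=
    (LinearMap.trace ℝ E ∘ₗ ContinuousLinearMap.coeLM ℝ).continuous_of_finiteDimensional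
  refine htrace.continuousAt.comp (continuousAt_clm_apply.mpr fun u ↦ ?_)
  simp only [connCurv_apply]
  have hu : ContinuousAt (fun _ ↦ u) a := continuousAt_const
  exact ((((hΓ'.clm_apply hu).clm_apply hv).clm_apply hw).sub
    (((hΓ'.clm_apply hv).clm_apply hu).clm_apply hw)).add
    ((hΓ.clm_apply hu).clm_apply ((hΓ.clm_apply hv).clm_apply hw)) |>.sub
    ((hΓ.clm_apply hv).clm_apply ((hΓ.clm_apply hu).clm_apply hw))

theorem eventually_connRicci_add_smul_pos [FiniteDimensional ℝ E] {Γ Γ' : E → E →L[ℝ] E →L[ℝ] E}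
    {y : E} (hΓ : ContDiffAt ℝ 1 Γ y) (hΓ' : ContDiffAt ℝ 1 Γ' y)
    (hpos : ∀ v ≠ 0, 0 < connRicci Γ y v v) :
    ∀ᶠ p : ℝ × E in 𝓝 (0, y), ∀ v ≠ 0, 0 < connRicci (Γ + p.1 • Γ') p.2 v v := by
  have hcont (v : E) : ContinuousAt
      (fun q : (ℝ × E) × E ↦ connRicci (Γ + q.1.1 • Γ') q.1.2 q.2 q.2) ((0, y), v) := by
    have hscale : ContinuousAt (fun q : (ℝ × E) × E ↦ q.1.1) ((0, y), v) := by fun_prop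
    have hpoint : ContinuousAt (fun q : (ℝ × E) × E ↦ q.1.2) ((0, y), v) := by fun_prop
    have comp {A : Type _} [TopologicalSpace A] {f : E → A} (hf : ContinuousAt f y) :
        ContinuousAt (fun q : (ℝ × E) × E ↦ f q.1.2) ((0, y), v) :=
      ContinuousAt.comp (f := fun q : (ℝ × E) × E ↦ q.1.2) hf hpoint
    have dΓ := comp (hΓ.fderiv_right (m := 0) (by simp)).continuousAt
    have dΓ' := comp (hΓ'.fderiv_right (m := 0) (by simp)).continuousAt
    have hfderiv : (fun q : (ℝ × E) × E ↦ fderiv ℝ (Γ + q.1.1 • Γ') q.1.2) =ᶠ[𝓝 ((0, y), v)]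
        fun q ↦ fderiv ℝ Γ q.1.2 + q.1.1 • fderiv ℝ Γ' q.1.2 := by
      filter_upwards [hpoint.eventually (hΓ.eventually (by simp)),
        hpoint.eventually (hΓ'.eventually (by simp))] with q hq hq'
      rw [fderiv_add (hq.differentiableAt (by simp))
        ((hq'.differentiableAt (by simp)).const_smul _),
        fderiv_const_smul (hq'.differentiableAt (by simp))]
    exact continuousAt_connRicci ((comp hΓ.continuousAt).add
      (hscale.smul (comp hΓ'.continuousAt))) ((dΓ.add (hscale.smul dΓ')).congr hfderiv.symm)
      continuousAt_snd continuousAt_snd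
  have hsphere : ∀ᶠ p : ℝ × E in 𝓝 (0, y), ∀ v ∈ Metric.sphere (0 : E) 1,
      0 < connRicci (Γ + p.1 • Γ') p.2 v v :=
    (isCompact_sphere 0 1).eventually_forall_of_forall_eventually fun v hv ↦
      (hcont v).eventually (lt_mem_nhds (by
        simpa using hpos v (Metric.ne_of_mem_sphere hv one_ne_zero)))
  filter_upwards [hsphere] with p hp v hv
  have hunit := hp (‖v‖⁻¹ • v) (by simp [norm_smul, hv])
  rw [connRicci_smul] at hunit
  exact pos_of_mul_pos_right hunit (sq_nonneg _)

end Connection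

section Metric

variable {E E' : Type*} [NormedAddCommGroup E] [NormedSpace ℝ E]
  [NormedAddCommGroup E'] [NormedSpace ℝ E']

/-- A bounded bilinear form which is symmetric and positive definite: the value of a Riemannian
metric at a point. -/
structure IsInnerForm (b : E →L[ℝ] E →L[ℝ] ℝ) : Prop where
  symm : ∀ v w, b v w = b w v
  pos : ∀ v, v ≠ 0 → 0 < b v v

theorem IsInnerForm.eq_of_forall {b : E →L[ℝ] E →L[ℝ] ℝ} (hb : IsInnerForm b) {v w : E}
    (h : ∀ z, b v z = b w z) : v = w := by
  by_contra hne
  refine (hb.pos (v - w) (sub_ne_zero.mpr hne)).ne' ?_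
  rw [map_sub b, sub_apply, h, sub_self]

theorem IsInnerForm.isInvertible [FiniteDimensional ℝ E] {b : E →L[ℝ] E →L[ℝ] ℝ}
    (hb : IsInnerForm b) : b.IsInvertible := by
  have hinj : Function.Injective b.toLinearMap := fun v w h ↦
    hb.eq_of_forall fun z ↦ DFunLike.congr_fun (show b v = b w from h) z
  have hfr : Module.finrank ℝ E = Module.finrank ℝ (E →L[ℝ] ℝ) := by
    rw [← LinearEquiv.finrank_eq (LinearMap.toContinuousLinearMap (𝕜 := ℝ) (E := E) (F' := ℝ))]
    exact (Subspace.dual_finrank_eq (K := ℝ) (V := E)).symm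
  exact ⟨(LinearMap.linearEquivOfInjective _ hinj hfr).toContinuousLinearEquiv, rfl⟩

theorem contDiffAt_inverse_of_isInnerForm [FiniteDimensional ℝ E] {H : E' → E →L[ℝ] E →L[ℝ] ℝ}
    {x : E'} {n : WithTop ℕ∞} (h : ContDiffAt ℝ n H x) (hin : IsInnerForm (H x)) :
    ContDiffAt ℝ n (fun z ↦ (H z).inverse) x :=
  hin.isInvertible.contDiffAt_map_inverse.comp x h

theorem IsInnerForm.bilinearComp {b : E' →L[ℝ] E' →L[ℝ] ℝ} (hb : IsInnerForm b)
    {A : E →L[ℝ] E'} (hA : Function.Injective A) : IsInnerForm (b.bilinearComp A A) where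
  symm _ _ := hb.symm _ _
  pos _ hv := hb.pos _ ((map_ne_zero_iff A hA).mpr hv)

section Christoffel

variable {G : E → E →L[ℝ] E →L[ℝ] ℝ} {y : E}

theorem inner_christoffel [FiniteDimensional ℝ E] (hG : IsInnerForm (G y)) (v w z : E) :
    G y (christoffel G y v w) z = koszulForm G y v w z := by
  rw [christoffel_apply, hG.isInvertible.self_apply_inverse]

theorem christoffel_eq_iff [FiniteDimensional ℝ E] (hG : IsInnerForm (G y)) {v w x : E} :
    christoffel G y v w = x ↔ ∀ z, G y x z = koszulForm G y v w z := by
  constructor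
  · rintro rfl z
    exact inner_christoffel hG v w z
  · intro h
    exact hG.eq_of_forall fun z ↦ by rw [h, inner_christoffel hG]

theorem fderiv_symm (hd : DifferentiableAt ℝ G y)
    (hG : ∀ᶠ z in 𝓝 y, ∀ v w, G z v w = G z w v) (u v w : E) :
    fderiv ℝ G y u v w = fderiv ℝ G y u w v := by
  rw [← fderiv_bilin_apply_const hd, ← fderiv_bilin_apply_const hd]
  exact DFunLike.congr_fun (EventuallyEq.fderiv_eq (hG.mono fun z hz ↦ hz v w)) u

theorem koszulForm_symm (hd : DifferentiableAt ℝ G y)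
    (hG : ∀ᶠ z in 𝓝 y, ∀ v w, G z v w = G z w v) (v w : E) :
    koszulForm G y v w = koszulForm G y w v := by
  ext z
  rw [koszulForm_apply, koszulForm_apply, fderiv_symm hd hG z v w]
  ring

theorem christoffel_symm (hd : DifferentiableAt ℝ G y)
    (hG : ∀ᶠ z in 𝓝 y, ∀ v w, G z v w = G z w v) (v w : E) :
    christoffel G y v w = christoffel G y w v := by
  rw [christoffel_apply, christoffel_apply, koszulForm_symm hd hG]

theorem contDiffAt_koszulForm [FiniteDimensional ℝ E] {m n : WithTop ℕ∞}
    (h : ContDiffAt ℝ n G y) (hmn : m + 1 ≤ n) : ContDiffAt ℝ m (koszulForm G) y := by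
  have h' : ContDiffAt ℝ m (fderiv ℝ G) y := h.fderiv_right hmn
  refine contDiffAt_clm_of_apply fun u ↦ contDiffAt_bilin_of_apply fun v w ↦ ?_
  simp only [koszulForm_apply]
  fun_prop

theorem contDiffAt_christoffel [FiniteDimensional ℝ E] {m n : WithTop ℕ∞}
    (h : ContDiffAt ℝ n G y) (hmn : m + 1 ≤ n) (hG : IsInnerForm (G y)) :
    ContDiffAt ℝ m (christoffel G) y := by
  have hkoszul := contDiffAt_koszulForm h hmn
  have hinverse : ContDiffAt ℝ m (fun z ↦ (G z).inverse) y :=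
    contDiffAt_inverse_of_isInnerForm (h.of_le (le_self_add.trans hmn)) hG
  refine contDiffAt_bilin_of_apply fun v w ↦ ?_
  simp only [christoffel_apply]
  fun_prop

end Christoffel

/-- `G` is the pull-back of the metric `G'` under `φ`, near `y`. -/
def IsPullbackAt (φ : E → E') (G : E → E →L[ℝ] E →L[ℝ] ℝ) (G' : E' → E' →L[ℝ] E' →L[ℝ] ℝ)
    (y : E) : Prop :=
  ∀ᶠ z in 𝓝 y, ∀ v w, G z v w = G' (φ z) (fderiv ℝ φ z v) (fderiv ℝ φ z w)

namespace IsPullbackAt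

variable {φ : E → E'} {G : E → E →L[ℝ] E →L[ℝ] ℝ} {G' : E' → E' →L[ℝ] E' →L[ℝ] ℝ} {y : E}

theorem fderiv_eq (h : IsPullbackAt φ G G' y) (hφ : ContDiffAt ℝ 2 φ y)
    (hG : DifferentiableAt ℝ G y) (hG' : DifferentiableAt ℝ G' (φ y)) (u v w : E) :
    fderiv ℝ G y u v w =
      fderiv ℝ G' (φ y) (fderiv ℝ φ y u) (fderiv ℝ φ y v) (fderiv ℝ φ y w)
      + G' (φ y) (fderiv ℝ (fderiv ℝ φ) y u v) (fderiv ℝ φ y w)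
      + G' (φ y) (fderiv ℝ φ y v) (fderiv ℝ (fderiv ℝ φ) y u w) := by
  have d₀ : DifferentiableAt ℝ φ y := hφ.differentiableAt (by norm_num)
  have d₁ : DifferentiableAt ℝ (fderiv ℝ φ) y :=
    (hφ.fderiv_right (m := 1) (by norm_num)).differentiableAt (by norm_num)
  have dG' : DifferentiableAt ℝ (fun z ↦ G' (φ z)) y := hG'.comp y d₀
  rw [← fderiv_bilin_apply_const hG,
    EventuallyEq.fderiv_eq (h.mono fun z hz ↦ hz v w : ∀ᶠ z in 𝓝 y, G z v w = _),
    fderiv_bilin_apply_apply dG' (by fun_prop) (by fun_prop), fderiv_clm_apply_const d₁,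
    fderiv_clm_apply_const d₁, fderiv_fun_comp _ hG' d₀, ContinuousLinearMap.comp_apply]

theorem koszulForm_eq (h : IsPullbackAt φ G G' y) (hφ : ContDiffAt ℝ 2 φ y)
    (hG : DifferentiableAt ℝ G y) (hG' : DifferentiableAt ℝ G' (φ y))
    (hsymm : ∀ v w, G' (φ y) v w = G' (φ y) w v) (v w z : E) :
    koszulForm G y v w z =
      koszulForm G' (φ y) (fderiv ℝ φ y v) (fderiv ℝ φ y w) (fderiv ℝ φ y z)
      + G' (φ y) (fderiv ℝ (fderiv ℝ φ) y v w) (fderiv ℝ φ y z) := by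
  have symm₂ := hφ.isSymmSndFDerivAt (by simp)
  rw [koszulForm_apply, koszulForm_apply]
  simp only [h.fderiv_eq hφ hG hG']
  rw [symm₂.eq w v, symm₂.eq w z, symm₂.eq v z, hsymm (fderiv ℝ φ y v), hsymm (fderiv ℝ φ y w)]
  ring

theorem christoffel_eq [FiniteDimensional ℝ E] [FiniteDimensional ℝ E']
    (h : IsPullbackAt φ G G' y) (hφ : ContDiffAt ℝ 2 φ y) (hφi : (fderiv ℝ φ y).IsInvertible)
    (hG : DifferentiableAt ℝ G y) (hG' : DifferentiableAt ℝ G' (φ y))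
    (hin : IsInnerForm (G y)) (hin' : IsInnerForm (G' (φ y))) (v w : E) :
    fderiv ℝ φ y (christoffel G y v w) = fderiv ℝ (fderiv ℝ φ) y v w +
      christoffel G' (φ y) (fderiv ℝ φ y v) (fderiv ℝ φ y w) := by
  refine hin'.eq_of_forall fun x ↦ ?_
  obtain ⟨z, rfl⟩ := hφi.surjective x
  rw [← h.self_of_nhds, inner_christoffel hin, h.koszulForm_eq hφ hG hG' hin'.symm, map_add,
    add_apply, inner_christoffel hin', add_comm]

theorem isInnerForm (h : IsPullbackAt φ G G' y) (hφi : (fderiv ℝ φ y).IsInvertible)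
    (hin' : IsInnerForm (G' (φ y))) : IsInnerForm (G y) := by
  have hG : G y = (G' (φ y)).bilinearComp (fderiv ℝ φ y) (fderiv ℝ φ y) := by
    ext v w
    exact h.self_of_nhds v w
  exact hG ▸ hin'.bilinearComp hφi.injective

theorem contDiffAt [FiniteDimensional ℝ E] (h : IsPullbackAt φ G G' y) {n m : WithTop ℕ∞}
    (hφ : ContDiffAt ℝ n φ y) (hG' : ContDiffAt ℝ m G' (φ y)) (hmn : m + 1 ≤ n) :
    ContDiffAt ℝ m G y := by
  have hφ' : ContDiffAt ℝ m (fderiv ℝ φ) y := hφ.fderiv_right hmn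
  have hG'φ : ContDiffAt ℝ m (fun z ↦ G' (φ z)) y := hG'.comp y (hφ.of_le (le_self_add.trans hmn))
  refine contDiffAt_bilin_of_apply fun v w ↦ ?_
  have hφ'_apply (x : E) : ContDiffAt ℝ m (fun z ↦ fderiv ℝ φ z x) y :=
    hφ'.clm_apply contDiffAt_const
  exact ((hG'φ.clm_apply (hφ'_apply v)).clm_apply (hφ'_apply w)).congr_of_eventuallyEq
    (h.mono fun z hz ↦ hz v w)

theorem isAffineAt [FiniteDimensional ℝ E] [FiniteDimensional ℝ E']
    (h : IsPullbackAt φ G G' y) (hφ : ContDiffAt ℝ 3 φ y) (hφi : (fderiv ℝ φ y).IsInvertible)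
    (hG' : ContDiffAt ℝ 2 G' (φ y)) (hin' : ∀ᶠ z in 𝓝 (φ y), IsInnerForm (G' z)) :
    IsAffineAt φ (christoffel G) (christoffel G') y := by
  have hG : ContDiffAt ℝ 2 G y := h.contDiffAt hφ hG' (by norm_num)
  filter_upwards [h.eventually_nhds, hφ.continuousAt.eventually hin',
    eventually_isInvertible_fderiv (hφ.of_le (by norm_num)) hφi, hφ.eventually (by simp),
    hG.eventually (by simp), hφ.continuousAt.eventually (hG'.eventually (by simp))]
    with z hz hz' hzi hzφ hzG hzG' v w
  exact christoffel_eq hz (hzφ.of_le (by norm_num)) hzi (hzG.differentiableAt (by norm_num))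
    (hzG'.differentiableAt (by norm_num)) (isInnerForm hz hzi hz') hz' v w

theorem coordRicci_eq [FiniteDimensional ℝ E] [FiniteDimensional ℝ E']
    (h : IsPullbackAt φ G G' y) (hφ : ContDiffAt ℝ 3 φ y) (hφi : (fderiv ℝ φ y).IsInvertible)
    (hG' : ContDiffAt ℝ 2 G' (φ y)) (hin' : ∀ᶠ z in 𝓝 (φ y), IsInnerForm (G' z)) (v w : E) :
    coordRicci G y v w = coordRicci G' (φ y) (fderiv ℝ φ y v) (fderiv ℝ φ y w) := by
  have hG : ContDiffAt ℝ 2 G y := h.contDiffAt hφ hG' (by norm_num)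
  have hΓ : ContDiffAt ℝ 1 (christoffel G) y :=
    contDiffAt_christoffel hG (by norm_num) (h.isInnerForm hφi hin'.self_of_nhds)
  have hΓ' : ContDiffAt ℝ 1 (christoffel G') (φ y) :=
    contDiffAt_christoffel hG' (by norm_num) hin'.self_of_nhds
  rw [coordRicci_eq_connRicci, coordRicci_eq_connRicci]
  exact (h.isAffineAt hφ hφi hG' hin').connRicci_eq hφ hφi (hΓ.differentiableAt (by norm_num))
    (hΓ'.differentiableAt (by norm_num)) v w

end IsPullbackAt

end Metric

section Killing

variable {E : Type*} [NormedAddCommGroup E] [NormedSpace ℝ E]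

/-- The vector field `ξ` is Killing for the metric `G` at `y`, i.e. the Lie derivative of `G`
along `ξ` vanishes at `y`. -/
def IsKillingAt (G : E → E →L[ℝ] E →L[ℝ] ℝ) (ξ : E → E) (y : E) : Prop :=
  ∀ v w, fderiv ℝ G y (ξ y) v w + G y (fderiv ℝ ξ y v) w + G y v (fderiv ℝ ξ y w) = 0

variable {G : E → E →L[ℝ] E →L[ℝ] ℝ} {ξ : E → E} {y : E}

theorem fderiv_killing_equation (hG : ContDiffAt ℝ 2 G y) (hξ : ContDiffAt ℝ 2 ξ y)
    (hK : ∀ᶠ z in 𝓝 y, IsKillingAt G ξ z) (a v w : E) :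
    fderiv ℝ (fderiv ℝ G) y a (ξ y) v w + fderiv ℝ G y (fderiv ℝ ξ y a) v w
      + (fderiv ℝ G y a (fderiv ℝ ξ y v) w + G y (fderiv ℝ (fderiv ℝ ξ) y a v) w)
      + (fderiv ℝ G y a v (fderiv ℝ ξ y w) + G y v (fderiv ℝ (fderiv ℝ ξ) y a w)) = 0 := by
  have dG : DifferentiableAt ℝ G y := hG.differentiableAt (by norm_num)
  have dG₁ : DifferentiableAt ℝ (fderiv ℝ G) y :=
    (hG.fderiv_right (m := 1) (by norm_num)).differentiableAt (by norm_num)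
  have dξ : DifferentiableAt ℝ ξ y := hξ.differentiableAt (by norm_num)
  have dξ₁ : DifferentiableAt ℝ (fderiv ℝ ξ) y :=
    (hξ.fderiv_right (m := 1) (by norm_num)).differentiableAt (by norm_num)
  have key := DFunLike.congr_fun (EventuallyEq.fderiv_eq (𝕜 := ℝ) (hK.mono fun z hz ↦ hz v w)) a
  rw [fderiv_fun_add (by fun_prop) (by fun_prop), fderiv_fun_add (by fun_prop) (by fun_prop),
    add_apply, add_apply, fderiv_bilin_apply_const (by fun_prop), fderiv_clm_apply_apply dG₁ dξ,
    fderiv_bilin_apply_apply dG (by fun_prop) (by fun_prop),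
    fderiv_bilin_apply_apply dG (by fun_prop) (by fun_prop), fderiv_clm_apply_const dξ₁,
    fderiv_clm_apply_const dξ₁] at key
  simpa using key

theorem fderiv_koszulForm_apply (hG : ContDiffAt ℝ 2 G y) (a u w z : E) :
    fderiv ℝ (fun x ↦ koszulForm G x u w z) y a = (1 / 2) * (fderiv ℝ (fderiv ℝ G) y a u w z
      + fderiv ℝ (fderiv ℝ G) y a w u z - fderiv ℝ (fderiv ℝ G) y a z u w) := by
  have dG₁ : DifferentiableAt ℝ (fderiv ℝ G) y :=
    (hG.fderiv_right (m := 1) (by norm_num)).differentiableAt (by norm_num)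
  have h₃ (u v w : E) : fderiv ℝ (fun x ↦ fderiv ℝ G x u v w) y a =
      fderiv ℝ (fderiv ℝ G) y a u v w := by
    rw [fderiv_bilin_apply_const (by fun_prop), fderiv_clm_apply_const dG₁]
  simp only [koszulForm_apply]
  rw [fderiv_const_mul (by fun_prop), smul_apply, fderiv_fun_sub (by fun_prop) (by fun_prop),
    sub_apply, fderiv_fun_add (by fun_prop) (by fun_prop), add_apply, h₃, h₃, h₃, smul_eq_mul]

theorem fderiv_inner_christoffel [FiniteDimensional ℝ E] (hG : ContDiffAt ℝ 2 G y)
    (hin : ∀ᶠ z in 𝓝 y, IsInnerForm (G z)) (a u w z : E) :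
    fderiv ℝ G y a (christoffel G y u w) z + G y (fderiv ℝ (christoffel G) y a u w) z =
      fderiv ℝ (fun x ↦ koszulForm G x u w z) y a := by
  have dG : DifferentiableAt ℝ G y := hG.differentiableAt (by norm_num)
  have dΓ : DifferentiableAt ℝ (christoffel G) y :=
    (contDiffAt_christoffel (m := 1) hG (by norm_num) hin.self_of_nhds).differentiableAt
      (by norm_num)
  have hΓ : (fun x ↦ koszulForm G x u w z) =ᶠ[𝓝 y] fun x ↦ G x (christoffel G x u w) z :=
    hin.mono fun x hx ↦ (inner_christoffel hx u w z).symm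
  rw [hΓ.fderiv_eq, fderiv_bilin_apply_apply dG (by fun_prop) (by fun_prop),
    fderiv_bilin_apply_const dΓ]
  simp

theorem killing_christoffel [FiniteDimensional ℝ E] (hG : ContDiffAt ℝ 2 G y)
    (hξ : ContDiffAt ℝ 2 ξ y) (hin : ∀ᶠ z in 𝓝 y, IsInnerForm (G z))
    (hK : ∀ᶠ z in 𝓝 y, IsKillingAt G ξ z) (u w : E) :
    fderiv ℝ (fderiv ℝ ξ) y u w + fderiv ℝ (christoffel G) y (ξ y) u w
      + christoffel G y (fderiv ℝ ξ y u) w + christoffel G y u (fderiv ℝ ξ y w)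
      - fderiv ℝ ξ y (christoffel G y u w) = 0 := by
  have symmG := hG.isSymmSndFDerivAt (by simp)
  have symmξ := hξ.isSymmSndFDerivAt (by simp)
  have hin₀ := hin.self_of_nhds
  have symm_fderiv := fderiv_symm (hG.differentiableAt (by norm_num)) (hin.mono fun z hz ↦ hz.symm)
  refine hin₀.eq_of_forall fun z ↦ ?_
  have inner_Γ (u w z : E) := inner_christoffel hin₀ u w z
  simp only [koszulForm_apply] at inner_Γ
  have dΓ := fderiv_inner_christoffel hG hin (ξ y) u w z
  rw [fderiv_koszulForm_apply hG, symmG.eq (ξ y) u, symmG.eq (ξ y) w, symmG.eq (ξ y) z] at dΓ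
  -- The Killing equation is differentiated cyclically, as in the Koszul formula.
  have dKu := fderiv_killing_equation hG hξ hK u w z
  have dKw := fderiv_killing_equation hG hξ hK w u z
  have dKz := fderiv_killing_equation hG hξ hK z u w
  rw [symmξ.eq w u] at dKw
  rw [symmξ.eq z u, symmξ.eq z w] at dKz
  simp only [map_add, map_sub, map_zero, add_apply, sub_apply, zero_apply]
  linarith [hK.self_of_nhds (christoffel G y u w) z, inner_Γ (fderiv ℝ ξ y u) w z,
    inner_Γ u (fderiv ℝ ξ y w) z, inner_Γ u w (fderiv ℝ ξ y z),
    hin₀.symm w (fderiv ℝ (fderiv ℝ ξ) y u z), hin₀.symm u (fderiv ℝ (fderiv ℝ ξ) y w z),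
    symm_fderiv u (fderiv ℝ ξ y w) z, symm_fderiv w (fderiv ℝ ξ y u) z,
    symm_fderiv z (fderiv ℝ ξ y u) w, symm_fderiv (fderiv ℝ ξ y u) w z]

end Killing

/-! ### Connection metrics on a trivial bundle -/

section Submersion

variable {E E' : Type*} [NormedAddCommGroup E] [NormedSpace ℝ E]
  [NormedAddCommGroup E'] [NormedSpace ℝ E']

/-- The vertical projection of the connection on the trivial bundle `E × E' → E` with connection
form `ξ`. -/
def vertProj (ξ : E × E' → E →L[ℝ] E') (y : E × E') : E × E' →L[ℝ] E' :=
  ContinuousLinearMap.snd ℝ E E' + ξ y ∘L ContinuousLinearMap.fst ℝ E E'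

@[simp] theorem vertProj_apply (ξ : E × E' → E →L[ℝ] E') (y X : E × E') :
    vertProj ξ y X = X.2 + ξ y X.1 := rfl

/-- The horizontal lift of the connection on `E × E' → E` with connection form `ξ`. -/
def horLift (ξ : E × E' → E →L[ℝ] E') (y : E × E') : E →L[ℝ] E × E' :=
  (ContinuousLinearMap.id ℝ E).prod (-ξ y)

@[simp] theorem horLift_apply (ξ : E × E' → E →L[ℝ] E') (y : E × E') (v : E) :
    horLift ξ y v = (v, -ξ y v) := rfl

theorem horLift_add_vertProj (ξ : E × E' → E →L[ℝ] E') (y X : E × E') :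
    horLift ξ y X.1 + (0, vertProj ξ y X) = X := by
  ext <;> simp

/-- The pull-back to `E × E'` of a metric on the base `E`. -/
def baseMetric (GB : E → E →L[ℝ] E →L[ℝ] ℝ) (y : E × E') : E × E' →L[ℝ] E × E' →L[ℝ] ℝ :=
  (GB y.1).bilinearComp (ContinuousLinearMap.fst ℝ E E') (ContinuousLinearMap.fst ℝ E E')

@[simp] theorem baseMetric_apply (GB : E → E →L[ℝ] E →L[ℝ] ℝ) (y X Y : E × E') :
    baseMetric GB y X Y = GB y.1 X.1 Y.1 := rfl

/-- The metric `GF` on the fibers of `E × E' → E`, extended by zero on the horizontal vectors of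
the connection with form `ξ`. -/
def fiberMetric (GF : E' → E' →L[ℝ] E' →L[ℝ] ℝ) (ξ : E × E' → E →L[ℝ] E') (y : E × E') :
    E × E' →L[ℝ] E × E' →L[ℝ] ℝ :=
  (GF y.2).bilinearComp (vertProj ξ y) (vertProj ξ y)

/-- The connection metric on `E × E'`, with the fibers scaled by `s`. -/
def connMetric (GB : E → E →L[ℝ] E →L[ℝ] ℝ) (GF : E' → E' →L[ℝ] E' →L[ℝ] ℝ)
    (ξ : E × E' → E →L[ℝ] E') (s : ℝ) (y : E × E') : E × E' →L[ℝ] E × E' →L[ℝ] ℝ :=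
  baseMetric GB y + s • fiberMetric GF ξ y

theorem connMetric_apply (GB : E → E →L[ℝ] E →L[ℝ] ℝ) (GF : E' → E' →L[ℝ] E' →L[ℝ] ℝ)
    (ξ : E × E' → E →L[ℝ] E') (s : ℝ) (y X Y : E × E') :
    connMetric GB GF ξ s y X Y =
      GB y.1 X.1 Y.1 + s * GF y.2 (X.2 + ξ y X.1) (Y.2 + ξ y Y.1) := rfl

/-- The local data, near `y`, of a connection metric whose connection form takes values in the
Killing fields of the fibers. With three derivatives the Christoffel symbols are twice
differentiable. -/
structure IsConnectionData (GB : E → E →L[ℝ] E →L[ℝ] ℝ) (GF : E' → E' →L[ℝ] E' →L[ℝ] ℝ)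
    (ξ : E × E' → E →L[ℝ] E') (y : E × E') : Prop where
  base : ContDiffAt ℝ 3 GB y.1
  fiber : ContDiffAt ℝ 3 GF y.2
  form : ContDiffAt ℝ 3 ξ y
  base_inner : ∀ᶠ b in 𝓝 y.1, IsInnerForm (GB b)
  fiber_inner : ∀ᶠ f in 𝓝 y.2, IsInnerForm (GF f)
  killing : ∀ᶠ z in 𝓝 y, ∀ v, IsKillingAt GF (fun f ↦ ξ (z.1, f) v) z.2

variable {GB : E → E →L[ℝ] E →L[ℝ] ℝ} {GF : E' → E' →L[ℝ] E' →L[ℝ] ℝ}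
  {ξ : E × E' → E →L[ℝ] E'} {y : E × E'} {s : ℝ}

theorem IsConnectionData.eventually (h : IsConnectionData GB GF ξ y) :
    ∀ᶠ z in 𝓝 y, IsConnectionData GB GF ξ z := by
  have hfst : Tendsto Prod.fst (𝓝 y) (𝓝 y.1) := continuous_fst.tendsto y
  have hsnd : Tendsto Prod.snd (𝓝 y) (𝓝 y.2) := continuous_snd.tendsto y
  filter_upwards [hfst.eventually (h.base.eventually (by simp)),
    hsnd.eventually (h.fiber.eventually (by simp)), h.form.eventually (by simp),
    hfst.eventually h.base_inner.eventually_nhds, hsnd.eventually h.fiber_inner.eventually_nhds,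
    h.killing.eventually_nhds] with z hbase hfiber hform hbase_inner hfiber_inner hkilling
  exact ⟨hbase, hfiber, hform, hbase_inner, hfiber_inner, hkilling⟩

theorem isInnerForm_connMetric (hB : IsInnerForm (GB y.1)) (hF : IsInnerForm (GF y.2))
    (hs : 0 < s) : IsInnerForm (connMetric GB GF ξ s y) where
  symm X Y := by rw [connMetric_apply, connMetric_apply, hB.symm, hF.symm]
  pos X hX := by
    rw [connMetric_apply]
    by_cases hX₁ : X.1 = 0
    · have hX₂ : X.2 ≠ 0 := fun hX₂ ↦ hX (Prod.ext hX₁ hX₂)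
      simpa [hX₁] using mul_pos hs (hF.pos _ hX₂)
    · refine add_pos_of_pos_of_nonneg (hB.pos _ hX₁) (mul_nonneg hs.le ?_)
      by_cases hvert : X.2 + ξ y X.1 = 0
      · simp [hvert]
      · exact (hF.pos _ hvert).le

/-- The horizontal vector dual to a functional, with respect to `GB`. -/
def horSharp (GB : E → E →L[ℝ] E →L[ℝ] ℝ) (ξ : E × E' → E →L[ℝ] E') (y : E × E') :
    (E × E' →L[ℝ] ℝ) →L[ℝ] E × E' :=
  horLift ξ y ∘L (GB y.1).inverse ∘L (ContinuousLinearMap.compL ℝ E (E × E') ℝ).flip (horLift ξ y)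

theorem horSharp_apply (ℓ : E × E' →L[ℝ] ℝ) :
    horSharp GB ξ y ℓ = horLift ξ y ((GB y.1).inverse (ℓ ∘L horLift ξ y)) := rfl

/-- The vertical vector dual to a functional, with respect to `GF`. -/
def verSharp (GF : E' → E' →L[ℝ] E' →L[ℝ] ℝ) (y : E × E') : (E × E' →L[ℝ] ℝ) →L[ℝ] E × E' :=
  ContinuousLinearMap.inr ℝ E E' ∘L (GF y.2).inverse ∘L
    (ContinuousLinearMap.compL ℝ E' (E × E') ℝ).flip (ContinuousLinearMap.inr ℝ E E')

theorem verSharp_apply (ℓ : E × E' →L[ℝ] ℝ) :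
    verSharp GF y ℓ = (0, (GF y.2).inverse (ℓ ∘L ContinuousLinearMap.inr ℝ E E')) := rfl

theorem connMetric_horSharp [FiniteDimensional ℝ E] (hB : IsInnerForm (GB y.1))
    (ℓ : E × E' →L[ℝ] ℝ) (Z : E × E') :
    connMetric GB GF ξ s y (horSharp GB ξ y ℓ) Z = ℓ (horLift ξ y Z.1) := by
  simp [connMetric_apply, horSharp_apply, hB.isInvertible.self_apply_inverse]

theorem connMetric_verSharp [FiniteDimensional ℝ E'] (hF : IsInnerForm (GF y.2))
    (ℓ : E × E' →L[ℝ] ℝ) (Z : E × E') :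
    connMetric GB GF ξ s y (verSharp GF y ℓ) Z = s * ℓ (0, vertProj ξ y Z) := by
  simp [connMetric_apply, verSharp_apply, hF.isInvertible.self_apply_inverse]

/-- The limit of the Christoffel symbols of the connection metric as the fibers collapse. -/
def limitConn (GB : E → E →L[ℝ] E →L[ℝ] ℝ) (GF : E' → E' →L[ℝ] E' →L[ℝ] ℝ)
    (ξ : E × E' → E →L[ℝ] E') (y : E × E') : E × E' →L[ℝ] E × E' →L[ℝ] E × E' :=
  ContinuousLinearMap.compL ℝ (E × E') (E × E' →L[ℝ] ℝ) (E × E') (horSharp GB ξ y) ∘L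
      koszulForm (baseMetric GB) y
    + ContinuousLinearMap.compL ℝ (E × E') (E × E' →L[ℝ] ℝ) (E × E') (verSharp GF y) ∘L
      koszulForm (fiberMetric GF ξ) y

theorem limitConn_apply (X Y : E × E') : limitConn GB GF ξ y X Y =
    horSharp GB ξ y (koszulForm (baseMetric GB) y X Y)
      + verSharp GF y (koszulForm (fiberMetric GF ξ) y X Y) := rfl

/-- The derivative of the Christoffel symbols of the connection metric in the scale of the
fibers. -/
def linearConn (GB : E → E →L[ℝ] E →L[ℝ] ℝ) (GF : E' → E' →L[ℝ] E' →L[ℝ] ℝ)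
    (ξ : E × E' → E →L[ℝ] E') (y : E × E') : E × E' →L[ℝ] E × E' →L[ℝ] E × E' :=
  ContinuousLinearMap.compL ℝ (E × E') (E × E' →L[ℝ] ℝ) (E × E') (horSharp GB ξ y) ∘L
      koszulForm (fiberMetric GF ξ) y

theorem linearConn_apply (X Y : E × E') : linearConn GB GF ξ y X Y =
    horSharp GB ξ y (koszulForm (fiberMetric GF ξ) y X Y) := rfl

theorem isPullbackAt_fst_baseMetric :
    IsPullbackAt Prod.fst (baseMetric GB) GB y :=
  .of_forall fun z v w ↦ by simp [fderiv_fst]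

theorem contDiffAt_horSharp [FiniteDimensional ℝ E] {n : WithTop ℕ∞} (hB : ContDiffAt ℝ n GB y.1)
    (hξ : ContDiffAt ℝ n ξ y) (hin : IsInnerForm (GB y.1)) : ContDiffAt ℝ n (horSharp GB ξ) y := by
  have hinverse : ContDiffAt ℝ n (fun z : E × E' ↦ (GB z.1).inverse) y :=
    contDiffAt_inverse_of_isInnerForm (hB.comp y contDiffAt_fst) hin
  have hlift : ContDiffAt ℝ n (horLift ξ) y := contDiffAt_clm_of_apply fun v ↦ by
    simp only [horLift_apply]
    fun_prop
  unfold horSharp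
  fun_prop

theorem contDiffAt_verSharp [FiniteDimensional ℝ E'] {n : WithTop ℕ∞}
    (hF : ContDiffAt ℝ n GF y.2) (hin : IsInnerForm (GF y.2)) :
    ContDiffAt ℝ n (verSharp (E := E) GF) y := by
  have hinverse : ContDiffAt ℝ n (fun z : E × E' ↦ (GF z.2).inverse) y :=
    contDiffAt_inverse_of_isInnerForm (hF.comp y contDiffAt_snd) hin
  unfold verSharp
  fun_prop

theorem koszulForm_add_smul {G H : E → E →L[ℝ] E →L[ℝ] ℝ} {x : E} (hG : DifferentiableAt ℝ G x)
    (hH : DifferentiableAt ℝ H x) (c : ℝ) (v w z : E) :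
    koszulForm (fun x ↦ G x + c • H x) x v w z =
      koszulForm G x v w z + c * koszulForm H x v w z := by
  have hfderiv : fderiv ℝ (fun x ↦ G x + c • H x) x = fderiv ℝ G x + c • fderiv ℝ H x :=
    (hG.hasFDerivAt.add (hH.hasFDerivAt.const_smul c)).fderiv
  simp only [koszulForm_apply, hfderiv, add_apply, smul_apply, smul_eq_mul]
  ring

variable [FiniteDimensional ℝ E] [FiniteDimensional ℝ E']

theorem contDiffAt_baseMetric {n : WithTop ℕ∞} (hB : ContDiffAt ℝ n GB y.1) :
    ContDiffAt ℝ n (baseMetric (E' := E') GB) y :=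
  isPullbackAt_fst_baseMetric.contDiffAt (n := n + 1) contDiffAt_fst hB le_rfl

theorem koszulForm_baseMetric (hB : ContDiffAt ℝ 1 GB y.1) (hin : IsInnerForm (GB y.1))
    (X Y Z : E × E') :
    koszulForm (baseMetric GB) y X Y Z = koszulForm GB y.1 X.1 Y.1 Z.1 := by
  have hfst : fderiv ℝ (Prod.fst : E × E' → E) = fun _ ↦ ContinuousLinearMap.fst ℝ E E' :=
    funext fun _ ↦ fderiv_fst
  rw [isPullbackAt_fst_baseMetric.koszulForm_eq contDiffAt_fst
    ((contDiffAt_baseMetric hB).differentiableAt (by norm_num))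
    (hB.differentiableAt (by norm_num)) hin.symm, hfst]
  simp

theorem contDiffAt_fiberMetric {n : WithTop ℕ∞} (hF : ContDiffAt ℝ n GF y.2)
    (hξ : ContDiffAt ℝ n ξ y) : ContDiffAt ℝ n (fiberMetric GF ξ) y := by
  have hvert (X : E × E') : ContDiffAt ℝ n (fun z : E × E' ↦ X.2 + ξ z X.1) y := by fun_prop
  refine contDiffAt_bilin_of_apply fun X Y ↦ ?_
  exact ((hF.comp y contDiffAt_snd).clm_apply (hvert X)).clm_apply (hvert Y)

theorem contDiffAt_connMetric {n : WithTop ℕ∞} (hB : ContDiffAt ℝ n GB y.1)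
    (hF : ContDiffAt ℝ n GF y.2) (hξ : ContDiffAt ℝ n ξ y) :
    ContDiffAt ℝ n (connMetric GB GF ξ s) y :=
  (contDiffAt_baseMetric hB).add ((contDiffAt_fiberMetric hF hξ).const_smul s)

theorem contDiffAt_linearConn (h : IsConnectionData GB GF ξ y) :
    ContDiffAt ℝ 2 (linearConn GB GF ξ) y := by
  have hsharp : ContDiffAt ℝ 2 (horSharp GB ξ) y :=
    (contDiffAt_horSharp h.base h.form h.base_inner.self_of_nhds).of_le (by norm_num)
  have hkoszul := contDiffAt_koszulForm (m := 2) (contDiffAt_fiberMetric h.fiber h.form)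
    (by norm_num)
  unfold linearConn
  fun_prop

theorem contDiffAt_limitConn (h : IsConnectionData GB GF ξ y) :
    ContDiffAt ℝ 2 (limitConn GB GF ξ) y := by
  have hhor : ContDiffAt ℝ 2 (horSharp GB ξ) y :=
    (contDiffAt_horSharp h.base h.form h.base_inner.self_of_nhds).of_le (by norm_num)
  have hver : ContDiffAt ℝ 2 (verSharp (E := E) GF) y :=
    (contDiffAt_verSharp h.fiber h.fiber_inner.self_of_nhds).of_le (by norm_num)
  have hbase := contDiffAt_koszulForm (m := 2) (contDiffAt_baseMetric (E' := E') h.base)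
    (by norm_num)
  have hfiber := contDiffAt_koszulForm (m := 2) (contDiffAt_fiberMetric h.fiber h.form)
    (by norm_num)
  unfold limitConn
  fun_prop

theorem christoffel_connMetric (h : IsConnectionData GB GF ξ y) (hs : 0 < s) :
    christoffel (connMetric GB GF ξ s) y = limitConn GB GF ξ y + s • linearConn GB GF ξ y := by
  have hB := h.base_inner.self_of_nhds
  have hF := h.fiber_inner.self_of_nhds
  refine ContinuousLinearMap.ext fun X ↦ ContinuousLinearMap.ext fun Y ↦ ?_
  refine (christoffel_eq_iff (isInnerForm_connMetric hB hF hs)).mpr fun Z ↦ ?_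
  have hsum : koszulForm (connMetric GB GF ξ s) y X Y Z = koszulForm (baseMetric GB) y X Y Z
      + s * koszulForm (fiberMetric GF ξ) y X Y Z :=
    koszulForm_add_smul ((contDiffAt_baseMetric h.base).differentiableAt (by norm_num))
      ((contDiffAt_fiberMetric h.fiber h.form).differentiableAt (by norm_num)) s X Y Z
  have hbase : koszulForm (baseMetric GB) y X Y Z =
      koszulForm (baseMetric GB) y X Y (horLift ξ y Z.1) := by
    rw [koszulForm_baseMetric (h.base.of_le (by norm_num)) hB,
      koszulForm_baseMetric (h.base.of_le (by norm_num)) hB, horLift_apply]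
  have hfiber : koszulForm (fiberMetric GF ξ) y X Y Z =
      koszulForm (fiberMetric GF ξ) y X Y (horLift ξ y Z.1) +
      koszulForm (fiberMetric GF ξ) y X Y (0, vertProj ξ y Z) := by
    rw [← map_add, horLift_add_vertProj]
  simp only [add_apply, smul_apply, limitConn_apply, linearConn_apply, map_add, map_smul]
  rw [connMetric_horSharp hB, connMetric_horSharp hB, connMetric_verSharp hF, hsum, hbase, hfiber,
    smul_eq_mul]
  ring

end Submersion

/-! ### The collapse of the fibers -/

section Slice

variable {E E' : Type*} [NormedAddCommGroup E] [NormedSpace ℝ E]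
  [NormedAddCommGroup E'] [NormedSpace ℝ E'] {ξ : E × E' → E →L[ℝ] E'} {y : E × E'}

theorem fderiv_comp_prodMk_right {F : Type*} [NormedAddCommGroup F] [NormedSpace ℝ F]
    {g : E × E' → F} (hg : DifferentiableAt ℝ g y) (w : E') :
    fderiv ℝ (fun f ↦ g (y.1, f)) y.2 w = fderiv ℝ g y (0, w) := by
  have hslice := HasFDerivAt.comp (g := g) (f := fun f : E' ↦ (y.1, f)) y.2 hg.hasFDerivAt
    (hasFDerivAt_prodMk_right y.1 y.2)
  exact DFunLike.congr_fun hslice.fderiv w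

theorem contDiffAt_slice {n : WithTop ℕ∞} (hξ : ContDiffAt ℝ n ξ y) (v : E) :
    ContDiffAt ℝ n (fun f ↦ ξ (y.1, f) v) y.2 :=
  (ContDiffAt.comp (g := ξ) y.2 hξ (contDiff_prodMk_right y.1).contDiffAt).clm_apply
    contDiffAt_const

theorem fderiv_slice (hξ : DifferentiableAt ℝ ξ y) (v : E) (w : E') :
    fderiv ℝ (fun f ↦ ξ (y.1, f) v) y.2 w = fderiv ℝ ξ y (0, w) v := by
  rw [fderiv_comp_prodMk_right (g := fun z ↦ ξ z v) (by fun_prop), fderiv_clm_apply_const hξ]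

theorem fderiv_fderiv_slice (hξ : ContDiffAt ℝ 2 ξ y) (v : E) (u w : E') :
    fderiv ℝ (fderiv ℝ fun f ↦ ξ (y.1, f) v) y.2 u w =
      fderiv ℝ (fderiv ℝ ξ) y (0, u) (0, w) v := by
  have dslice : DifferentiableAt ℝ (fderiv ℝ fun f ↦ ξ (y.1, f) v) y.2 :=
    ((contDiffAt_slice hξ v).fderiv_right (m := 1) (by norm_num)).differentiableAt (by norm_num)
  have dξ₁ : DifferentiableAt ℝ (fderiv ℝ ξ) y :=
    (hξ.fderiv_right (m := 1) (by norm_num)).differentiableAt (by norm_num)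
  have hfirst : (fun f ↦ fderiv ℝ (fun f ↦ ξ (y.1, f) v) f w) =ᶠ[𝓝 y.2]
      fun f ↦ fderiv ℝ ξ (y.1, f) (0, w) v := by
    filter_upwards [(Continuous.prodMk_right y.1).continuousAt.eventually
      (hξ.eventually (by simp))] with f hf
    exact fderiv_slice (hf.differentiableAt (by norm_num)) v w
  rw [← fderiv_clm_apply_const dslice, hfirst.fderiv_eq,
    fderiv_comp_prodMk_right (g := fun z ↦ fderiv ℝ ξ z (0, w) v) (by fun_prop),
    fderiv_bilin_apply_const dξ₁]

end Slice

section Collapse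

variable {E E' : Type*} [NormedAddCommGroup E] [NormedSpace ℝ E]
  [NormedAddCommGroup E'] [NormedSpace ℝ E']
  {GB : E → E →L[ℝ] E →L[ℝ] ℝ} {GF : E' → E' →L[ℝ] E' →L[ℝ] ℝ}
  {ξ : E × E' → E →L[ℝ] E'} {y : E × E'}

theorem differentiableAt_vertProj_apply (hξ : DifferentiableAt ℝ ξ y) (X : E × E') :
    DifferentiableAt ℝ (fun z ↦ vertProj ξ z X) y := by
  simp only [vertProj_apply]
  fun_prop

theorem fderiv_vertProj_apply (hξ : DifferentiableAt ℝ ξ y) (U X : E × E') :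
    fderiv ℝ (fun z ↦ vertProj ξ z X) y U = fderiv ℝ ξ y U X.1 := by
  simp only [vertProj_apply, fderiv_const_add]
  rw [fderiv_clm_apply_const hξ]

theorem vertProj_limitConn [FiniteDimensional ℝ E'] (hF : IsInnerForm (GF y.2)) {X Y : E × E'}
    {x : E'} (h : ∀ z, GF y.2 x z = koszulForm (fiberMetric GF ξ) y X Y (0, z)) :
    vertProj ξ y (limitConn GB GF ξ y X Y) = x := by
  refine hF.eq_of_forall fun z ↦ ?_
  rw [h, limitConn_apply, horSharp_apply, verSharp_apply]
  simp [hF.isInvertible.self_apply_inverse]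

theorem killing_christoffel_form [FiniteDimensional ℝ E'] (h : IsConnectionData GB GF ξ y) (v : E)
    (u w : E') :
    fderiv ℝ (fderiv ℝ ξ) y (0, u) (0, w) v + fderiv ℝ (christoffel GF) y.2 (ξ y v) u w
      + christoffel GF y.2 (fderiv ℝ ξ y (0, u) v) w
      + christoffel GF y.2 u (fderiv ℝ ξ y (0, w) v)
      - fderiv ℝ ξ y (0, christoffel GF y.2 u w) v = 0 := by
  have hξ : ContDiffAt ℝ 2 ξ y := h.form.of_le (by norm_num)
  have hkilling : ∀ᶠ f in 𝓝 y.2, IsKillingAt GF (fun f ↦ ξ (y.1, f) v) f :=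
    ((Continuous.prodMk_right y.1).continuousAt.eventually h.killing).mono fun f hf ↦ hf v
  have key := killing_christoffel (h.fiber.of_le (by norm_num)) (contDiffAt_slice hξ v)
    h.fiber_inner hkilling u w
  simpa only [fderiv_fderiv_slice hξ, fderiv_slice (hξ.differentiableAt (by norm_num))] using key

variable [FiniteDimensional ℝ E] [FiniteDimensional ℝ E']

theorem fderiv_fiberMetric (hF : ContDiffAt ℝ 1 GF y.2) (hξ : ContDiffAt ℝ 1 ξ y)
    (U X Y : E × E') :
    fderiv ℝ (fiberMetric GF ξ) y U X Y = fderiv ℝ GF y.2 U.2 (vertProj ξ y X) (vertProj ξ y Y)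
      + GF y.2 (fderiv ℝ ξ y U X.1) (vertProj ξ y Y)
      + GF y.2 (vertProj ξ y X) (fderiv ℝ ξ y U Y.1) := by
  have dξ := hξ.differentiableAt (by norm_num)
  have dF := hF.differentiableAt (by norm_num)
  have dF' : DifferentiableAt ℝ (fun z : E × E' ↦ GF z.2) y := dF.comp y differentiableAt_snd
  have dfiber := (contDiffAt_fiberMetric hF hξ).differentiableAt (by norm_num)
  rw [← fderiv_bilin_apply_const dfiber]
  change fderiv ℝ (fun z ↦ GF z.2 (vertProj ξ z X) (vertProj ξ z Y)) y U = _
  rw [fderiv_bilin_apply_apply dF' (differentiableAt_vertProj_apply dξ X)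
    (differentiableAt_vertProj_apply dξ Y), fderiv_vertProj_apply dξ, fderiv_vertProj_apply dξ,
    fderiv_fun_comp _ dF differentiableAt_snd, fderiv_snd]
  rfl

theorem limitConn_fst (hB : ContDiffAt ℝ 1 GB y.1) (hin : IsInnerForm (GB y.1)) (X Y : E × E') :
    (limitConn GB GF ξ y X Y).1 = christoffel GB y.1 X.1 Y.1 := by
  rw [limitConn_apply, horSharp_apply, verSharp_apply, christoffel_apply]
  simp only [horLift_apply, Prod.fst_add, add_zero]
  congr 1
  ext z
  simp [koszulForm_baseMetric hB hin]

theorem limitConn_symm (h : IsConnectionData GB GF ξ y) (X Y : E × E') :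
    limitConn GB GF ξ y X Y = limitConn GB GF ξ y Y X := by
  have hbase : ∀ᶠ z in 𝓝 y, ∀ X Y : E × E', baseMetric GB z X Y = baseMetric GB z Y X :=
    (continuous_fst.continuousAt.eventually h.base_inner).mono fun z hz X Y ↦ hz.symm X.1 Y.1
  have hfiber : ∀ᶠ z in 𝓝 y, ∀ X Y, fiberMetric GF ξ z X Y = fiberMetric GF ξ z Y X :=
    (continuous_snd.continuousAt.eventually h.fiber_inner).mono fun z hz X Y ↦ hz.symm _ _
  rw [limitConn_apply, limitConn_apply,
    koszulForm_symm ((contDiffAt_baseMetric h.base).differentiableAt (by norm_num)) hbase,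
    koszulForm_symm ((contDiffAt_fiberMetric h.fiber h.form).differentiableAt (by norm_num)) hfiber]

theorem limitConn_vert (h : IsConnectionData GB GF ξ y) (u : E') (X : E × E') :
    limitConn GB GF ξ y (0, u) X =
      (0, christoffel GF y.2 u (vertProj ξ y X) + fderiv ℝ ξ y (0, u) X.1) := by
  have hF := h.fiber_inner.self_of_nhds
  have dξ := h.form.differentiableAt (by norm_num)
  have hfst : (limitConn GB GF ξ y (0, u) X).1 = 0 := by
    simp [limitConn_fst (h.base.of_le (by norm_num)) h.base_inner.self_of_nhds]
  have hvert : vertProj ξ y (limitConn GB GF ξ y (0, u) X) =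
      christoffel GF y.2 u (vertProj ξ y X) + fderiv ℝ ξ y (0, u) X.1 := by
    refine vertProj_limitConn hF fun z ↦ ?_
    have killing := h.killing.self_of_nhds X.1 u z
    have symm (x : E') := fderiv_symm (h.fiber.differentiableAt (by norm_num))
      (h.fiber_inner.mono fun f hf ↦ hf.symm) z u x
    rw [fderiv_slice dξ, fderiv_slice dξ] at killing
    rw [map_add, add_apply, inner_christoffel hF, koszulForm_apply, koszulForm_apply]
    simp only [fderiv_fiberMetric (h.fiber.of_le (by norm_num)) (h.form.of_le (by norm_num)),
      vertProj_apply, map_zero, add_zero, map_add, add_apply, zero_apply]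
    linarith [symm (ξ y X.1), symm X.2]
  refine Prod.ext hfst ?_
  rwa [vertProj_apply, hfst, map_zero, add_zero] at hvert

theorem limitConn_diag (h : IsConnectionData GB GF ξ y) (X : E × E') :
    limitConn GB GF ξ y X X =
      (christoffel GB y.1 X.1 X.1, christoffel GF y.2 (vertProj ξ y X) (vertProj ξ y X)
        + fderiv ℝ ξ y X X.1 + fderiv ℝ ξ y (0, vertProj ξ y X) X.1
        - ξ y (christoffel GB y.1 X.1 X.1)) := by
  have hF := h.fiber_inner.self_of_nhds
  have dξ := h.form.differentiableAt (by norm_num)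
  have hfst : (limitConn GB GF ξ y X X).1 = christoffel GB y.1 X.1 X.1 :=
    limitConn_fst (h.base.of_le (by norm_num)) h.base_inner.self_of_nhds X X
  have hvert : vertProj ξ y (limitConn GB GF ξ y X X) =
      christoffel GF y.2 (vertProj ξ y X) (vertProj ξ y X)
        + fderiv ℝ ξ y X X.1 + fderiv ℝ ξ y (0, vertProj ξ y X) X.1 := by
    refine vertProj_limitConn hF fun z ↦ ?_
    have killing := h.killing.self_of_nhds X.1 (vertProj ξ y X) z
    have symm := fderiv_symm (h.fiber.differentiableAt (by norm_num))
      (h.fiber_inner.mono fun f hf ↦ hf.symm) (vertProj ξ y X) (vertProj ξ y X) z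
    have hsplit : fderiv ℝ GF y.2 (vertProj ξ y X) =
        fderiv ℝ GF y.2 X.2 + fderiv ℝ GF y.2 (ξ y X.1) := by rw [vertProj_apply, map_add]
    have hz : vertProj ξ y (0, z) = z := by simp
    rw [fderiv_slice dξ, fderiv_slice dξ] at killing
    rw [map_add, map_add, add_apply, add_apply, inner_christoffel hF, koszulForm_apply,
      koszulForm_apply]
    simp only [fderiv_fiberMetric (h.fiber.of_le (by norm_num)) (h.form.of_le (by norm_num)), hz,
      hsplit, map_zero, add_apply]
    linarith [hF.symm (vertProj ξ y X) (fderiv ℝ ξ y (0, z) X.1)]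
  refine Prod.ext hfst ?_
  rw [vertProj_apply, hfst] at hvert
  exact eq_sub_of_add_eq hvert

theorem connCurv_limitConn_fst (h : IsConnectionData GB GF ξ y) (X U : E × E') :
    (connCurv (limitConn GB GF ξ) y X X U).1 = connCurv (christoffel GB) y.1 X.1 X.1 U.1 := by
  have hfst {z : E × E'} (hz : IsConnectionData GB GF ξ z) (X Y : E × E') :
      (limitConn GB GF ξ z X Y).1 = christoffel GB z.1 X.1 Y.1 :=
    limitConn_fst (hz.base.of_le (by norm_num)) hz.base_inner.self_of_nhds X Y
  have dΓ : DifferentiableAt ℝ (limitConn GB GF ξ) y :=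
    (contDiffAt_limitConn h).differentiableAt (by norm_num)
  have dB : DifferentiableAt ℝ (christoffel GB) y.1 :=
    (contDiffAt_christoffel (m := 2) h.base (by norm_num)
      h.base_inner.self_of_nhds).differentiableAt (by norm_num)
  have hfderiv (U X Y : E × E') : (fderiv ℝ (limitConn GB GF ξ) y U X Y).1 =
      fderiv ℝ (christoffel GB) y.1 U.1 X.1 Y.1 := by
    have dB' : DifferentiableAt ℝ (fun z : E × E' ↦ christoffel GB z.1) y :=
      dB.comp y differentiableAt_fst
    have key := DFunLike.congr_fun (EventuallyEq.fderiv_eq (𝕜 := ℝ)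
      (h.eventually.mono fun z hz ↦ hfst hz X Y)) U
    rwa [fderiv.fst (by fun_prop), ContinuousLinearMap.comp_apply, fderiv_bilin_apply_const dΓ,
      fderiv_bilin_apply_const dB', fderiv_fun_comp _ dB differentiableAt_fst, fderiv_fst] at key
  simp only [connCurv_apply, Prod.fst_add, Prod.fst_sub, hfderiv, hfst h]

theorem fderiv_limitConn_vert_snd (h : IsConnectionData GB GF ξ y) (U X : E × E') (u : E') :
    (fderiv ℝ (limitConn GB GF ξ) y U (0, u) X).2 =
      fderiv ℝ (christoffel GF) y.2 U.2 u (vertProj ξ y X)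
      + christoffel GF y.2 u (fderiv ℝ ξ y U X.1)
      + fderiv ℝ (fderiv ℝ ξ) y U (0, u) X.1 := by
  have dΓ : DifferentiableAt ℝ (limitConn GB GF ξ) y :=
    (contDiffAt_limitConn h).differentiableAt (by norm_num)
  have dF : DifferentiableAt ℝ (christoffel GF) y.2 :=
    (contDiffAt_christoffel (m := 2) h.fiber (by norm_num)
      h.fiber_inner.self_of_nhds).differentiableAt (by norm_num)
  have dF' : DifferentiableAt ℝ (fun z : E × E' ↦ christoffel GF z.2) y :=
    dF.comp y differentiableAt_snd
  have dξ : DifferentiableAt ℝ ξ y := h.form.differentiableAt (by norm_num)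
  have dvert := differentiableAt_vertProj_apply dξ
  have dξ₁ : DifferentiableAt ℝ (fderiv ℝ ξ) y :=
    (h.form.fderiv_right (m := 1) (by norm_num)).differentiableAt (by norm_num)
  have key := DFunLike.congr_fun (EventuallyEq.fderiv_eq (𝕜 := ℝ)
    (h.eventually.mono fun z hz ↦ congrArg Prod.snd (limitConn_vert hz u X))) U
  rw [fderiv.snd (by fun_prop), ContinuousLinearMap.comp_apply, fderiv_bilin_apply_const dΓ,
    fderiv_fun_add (by fun_prop) (by fun_prop), add_apply,
    fderiv_bilin_apply_apply dF' (by fun_prop) (dvert X), fderiv_vertProj_apply dξ,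
    fderiv_bilin_apply_const dξ₁, fderiv_fun_comp _ dF differentiableAt_snd, fderiv_snd] at key
  simpa using key

theorem fderiv_limitConn_diag_snd (h : IsConnectionData GB GF ξ y) (X : E × E') (u : E') :
    (fderiv ℝ (limitConn GB GF ξ) y (0, u) X X).2 =
      fderiv ℝ (christoffel GF) y.2 u (vertProj ξ y X) (vertProj ξ y X)
      + christoffel GF y.2 (fderiv ℝ ξ y (0, u) X.1) (vertProj ξ y X)
      + christoffel GF y.2 (vertProj ξ y X) (fderiv ℝ ξ y (0, u) X.1)
      + fderiv ℝ (fderiv ℝ ξ) y (0, u) X X.1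
      + (fderiv ℝ (fderiv ℝ ξ) y (0, u) (0, vertProj ξ y X) X.1
      + fderiv ℝ ξ y (0, fderiv ℝ ξ y (0, u) X.1) X.1)
      - fderiv ℝ ξ y (0, u) (christoffel GB y.1 X.1 X.1) := by
  have dΓ : DifferentiableAt ℝ (limitConn GB GF ξ) y :=
    (contDiffAt_limitConn h).differentiableAt (by norm_num)
  have dB : DifferentiableAt ℝ (christoffel GB) y.1 :=
    (contDiffAt_christoffel (m := 2) h.base (by norm_num)
      h.base_inner.self_of_nhds).differentiableAt (by norm_num)
  have dF : DifferentiableAt ℝ (christoffel GF) y.2 :=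
    (contDiffAt_christoffel (m := 2) h.fiber (by norm_num)
      h.fiber_inner.self_of_nhds).differentiableAt (by norm_num)
  have dB' : DifferentiableAt ℝ (fun z : E × E' ↦ christoffel GB z.1) y :=
    dB.comp y differentiableAt_fst
  have dF' : DifferentiableAt ℝ (fun z : E × E' ↦ christoffel GF z.2) y :=
    dF.comp y differentiableAt_snd
  have dξ : DifferentiableAt ℝ ξ y := h.form.differentiableAt (by norm_num)
  have dvert := differentiableAt_vertProj_apply dξ X
  have dξ₁ : DifferentiableAt ℝ (fderiv ℝ ξ) y :=
    (h.form.fderiv_right (m := 1) (by norm_num)).differentiableAt (by norm_num)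
  have key := DFunLike.congr_fun (EventuallyEq.fderiv_eq (𝕜 := ℝ)
    (h.eventually.mono fun z hz ↦ congrArg Prod.snd (limitConn_diag hz X))) ((0 : E), u)
  rw [fderiv.snd (by fun_prop), ContinuousLinearMap.comp_apply, fderiv_bilin_apply_const dΓ,
    fderiv_fun_sub (by fun_prop) (by fun_prop), sub_apply,
    fderiv_fun_add (by fun_prop) (by fun_prop), add_apply,
    fderiv_fun_add (by fun_prop) (by fun_prop), add_apply,
    fderiv_bilin_apply_apply dF' dvert dvert, fderiv_vertProj_apply dξ,
    fderiv_bilin_apply_const dξ₁, fderiv_bilin_apply_apply dξ₁ (by fun_prop) (by fun_prop),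
    fderiv_clm_apply_apply dξ (by fun_prop), fderiv_bilin_apply_const dB',
    fderiv_fun_comp _ dF differentiableAt_snd, fderiv_snd,
    fderiv_fun_comp _ dB differentiableAt_fst, fderiv_fst,
    DifferentiableAt.fderiv_prodMk (by fun_prop) dvert, ContinuousLinearMap.prod_apply,
    fderiv_vertProj_apply dξ] at key
  simpa using key

theorem connCurv_limitConn_vert_snd (h : IsConnectionData GB GF ξ y) (X : E × E') (u : E') :
    (connCurv (limitConn GB GF ξ) y X X (0, u)).2 =
      connCurv (christoffel GF) y.2 (vertProj ξ y X) (vertProj ξ y X) u := by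
  have symmξ := (h.form.of_le (m := 2) (by norm_num)).isSymmSndFDerivAt (by simp)
  have symmF := christoffel_symm (h.fiber.differentiableAt (by norm_num))
    (h.fiber_inner.mono fun z hz ↦ hz.symm)
  have hsplit : fderiv ℝ (christoffel GF) y.2 (vertProj ξ y X) =
      fderiv ℝ (christoffel GF) y.2 X.2 + fderiv ℝ (christoffel GF) y.2 (ξ y X.1) := by
    rw [vertProj_apply, map_add]
  have hvert (w w' : E') : fderiv ℝ ξ y (0, w + w') X.1 =
      fderiv ℝ ξ y (0, w) X.1 + fderiv ℝ ξ y (0, w') X.1 := by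
    rw [← add_apply, ← map_add, Prod.mk_add_mk, add_zero]
  have hdiag : vertProj ξ y (limitConn GB GF ξ y X X) =
      christoffel GF y.2 (vertProj ξ y X) (vertProj ξ y X)
        + fderiv ℝ ξ y X X.1 + fderiv ℝ ξ y (0, vertProj ξ y X) X.1 := by
    rw [limitConn_diag h, vertProj_apply]
    simp only [sub_add_cancel]
  have hdiag_fst : (limitConn GB GF ξ y X X).1 = christoffel GB y.1 X.1 X.1 := by
    rw [limitConn_diag h]
  rw [connCurv_apply, connCurv_apply, Prod.snd_sub, Prod.snd_add, Prod.snd_sub,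
    fderiv_limitConn_diag_snd h, fderiv_limitConn_vert_snd h,
    limitConn_vert h u (limitConn GB GF ξ y X X), limitConn_vert h u X,
    limitConn_symm h X (0, _), limitConn_vert h]
  dsimp only
  rw [symmξ.eq X (0, u), hsplit, hdiag, hdiag_fst, hvert,
    symmF (vertProj ξ y X) (christoffel GF y.2 u (vertProj ξ y X)),
    symmF (vertProj ξ y X) (fderiv ℝ ξ y (0, u) X.1)]
  simp only [map_add, add_apply]
  rw [← sub_eq_zero, ← killing_christoffel_form h X.1 u (vertProj ξ y X)]
  abel

theorem trace_prod_eq_add {R V W : Type*} [CommRing R] [AddCommGroup V] [Module R V]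
    [AddCommGroup W] [Module R W] [Module.Free R V] [Module.Finite R V] [Module.Free R W]
    [Module.Finite R W] (T : V × W →ₗ[R] V × W) :
    LinearMap.trace R (V × W) T =
      LinearMap.trace R V (LinearMap.fst R V W ∘ₗ T ∘ₗ LinearMap.inl R V W)
      + LinearMap.trace R W (LinearMap.snd R V W ∘ₗ T ∘ₗ LinearMap.inr R V W) := by
  have hT : T = (T ∘ₗ LinearMap.inl R V W) ∘ₗ LinearMap.fst R V W
      + (T ∘ₗ LinearMap.inr R V W) ∘ₗ LinearMap.snd R V W := by
    ext <;> simp [← Prod.zero_eq_mk]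
  conv_lhs => rw [hT, map_add, LinearMap.trace_comp_comm' (LinearMap.fst R V W),
    LinearMap.trace_comp_comm' (LinearMap.snd R V W)]

theorem connRicci_limitConn (h : IsConnectionData GB GF ξ y) (X : E × E') :
    connRicci (limitConn GB GF ξ) y X X =
      coordRicci GB y.1 X.1 X.1 + coordRicci GF y.2 (vertProj ξ y X) (vertProj ξ y X) := by
  rw [connRicci, trace_prod_eq_add, coordRicci_eq_connRicci, coordRicci_eq_connRicci, connRicci,
    connRicci]
  congr 2
  · ext v
    exact connCurv_limitConn_fst h X (v, 0)
  · ext w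
    exact connCurv_limitConn_vert_snd h X w

theorem connRicci_limitConn_pos (h : IsConnectionData GB GF ξ y)
    (hB : ∀ v ≠ 0, 0 < coordRicci GB y.1 v v) (hF : ∀ v ≠ 0, 0 < coordRicci GF y.2 v v)
    {X : E × E'} (hX : X ≠ 0) : 0 < connRicci (limitConn GB GF ξ) y X X := by
  have ricci_zero (Γ : E' → E' →L[ℝ] E' →L[ℝ] E') : connRicci Γ y.2 0 0 = 0 := by
    simpa using connRicci_smul Γ 0 y.2 0
  have ricci_zero' (Γ : E → E →L[ℝ] E →L[ℝ] E) : connRicci Γ y.1 0 0 = 0 := by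
    simpa using connRicci_smul Γ 0 y.1 0
  rw [connRicci_limitConn h]
  by_cases hX₁ : X.1 = 0
  · have hX₂ : vertProj ξ y X ≠ 0 := by
      simpa [hX₁] using fun hX₂ ↦ hX (Prod.ext hX₁ hX₂)
    rw [hX₁, coordRicci_eq_connRicci, ricci_zero', zero_add]
    exact hF _ hX₂
  · refine add_pos_of_pos_of_nonneg (hB _ hX₁) ?_
    by_cases hvert : vertProj ξ y X = 0
    · rw [hvert, coordRicci_eq_connRicci, ricci_zero]
    · exact (hF _ hvert).le

theorem coordRicci_connMetric (h : IsConnectionData GB GF ξ y) {s : ℝ} (hs : 0 < s)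
    (X Y : E × E') : coordRicci (connMetric GB GF ξ s) y X Y =
      connRicci (limitConn GB GF ξ + s • linearConn GB GF ξ) y X Y := by
  have heq : christoffel (connMetric GB GF ξ s) =ᶠ[𝓝 y]
      limitConn GB GF ξ + s • linearConn GB GF ξ :=
    h.eventually.mono fun z hz ↦ christoffel_connMetric hz hs
  rw [coordRicci_eq_connRicci, connRicci, connRicci, connCurv, connCurv, heq.fderiv_eq,
    heq.self_of_nhds]

theorem eventually_coordRicci_connMetric_pos (h : IsConnectionData GB GF ξ y)
    (hB : ∀ v ≠ 0, 0 < coordRicci GB y.1 v v) (hF : ∀ v ≠ 0, 0 < coordRicci GF y.2 v v) :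
    ∀ᶠ p : ℝ × (E × E') in 𝓝 (0, y), 0 < p.1 → ∀ X ≠ 0,
      0 < coordRicci (connMetric GB GF ξ p.1) p.2 X X := by
  have hdata : ∀ᶠ p : ℝ × (E × E') in 𝓝 (0, y), IsConnectionData GB GF ξ p.2 :=
    (continuous_snd.tendsto ((0 : ℝ), y)).eventually h.eventually
  filter_upwards [hdata, eventually_connRicci_add_smul_pos
    ((contDiffAt_limitConn h).of_le (by norm_num)) ((contDiffAt_linearConn h).of_le (by norm_num))
    fun X hX ↦ connRicci_limitConn_pos h hB hF hX] with p hp hpos hs X hX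
  rw [coordRicci_connMetric hp hs]
  exact hpos X hX

end Collapse

/-! ### Riemannian metrics in charts -/

section ManifoldDerivative

variable {E E' E'' : Type*} [NormedAddCommGroup E] [NormedSpace ℝ E]
  [NormedAddCommGroup E'] [NormedSpace ℝ E'] [NormedAddCommGroup E''] [NormedSpace ℝ E'']
  {M M' M'' : Type*} [TopologicalSpace M] [ChartedSpace E M] [TopologicalSpace M']
  [ChartedSpace E' M'] [TopologicalSpace M''] [ChartedSpace E'' M'']

/-- The manifold derivative, as a linear map between the model spaces instead of the tangent
spaces, which are definitionally equal to them. -/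
def mder (f : M → M') (x : M) : E →L[ℝ] E' := mfderiv 𝓘(ℝ, E) 𝓘(ℝ, E') f x

theorem mder_comp_of_eq {g : M' → M''} {f : M → M'} {x : M} {x' : M'} (hx : f x = x')
    (hg : MDifferentiableAt 𝓘(ℝ, E') 𝓘(ℝ, E'') g x')
    (hf : MDifferentiableAt 𝓘(ℝ, E) 𝓘(ℝ, E') f x) :
    (mder (fun z ↦ g (f z)) x : E →L[ℝ] E'') = (mder g x' : E' →L[ℝ] E'') ∘L mder f x := by
  subst hx
  exact mfderiv_comp x hg hf

theorem mder_congr {f g : M → M'} {x : M} (h : f =ᶠ[𝓝 x] g) :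
    (mder f x : E →L[ℝ] E') = mder g x := by
  unfold mder
  exact h.mfderiv_eq

theorem mder_eq_fderiv (f : E → E') (x : E) : mder f x = fderiv ℝ f x :=
  mfderiv_eq_fderiv

theorem mder_prodMk {f : M → E'} {g : M → E''} {x : M}
    (hf : MDifferentiableAt 𝓘(ℝ, E) 𝓘(ℝ, E') f x) (hg : MDifferentiableAt 𝓘(ℝ, E) 𝓘(ℝ, E'') g x) :
    (mder (fun z ↦ (f z, g z)) x : E →L[ℝ] E' × E'') = (mder f x : E →L[ℝ] E').prod (mder g x) := by
  have h : HasMFDerivAt 𝓘(ℝ, E) 𝓘(ℝ, E' × E'') (fun z ↦ (f z, g z)) x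
      ((mder f x : E →L[ℝ] E').prod (mder g x : E →L[ℝ] E'')) :=
    ⟨hf.continuousAt.prodMk hg.continuousAt, hf.hasMFDerivAt.2.prodMk hg.hasMFDerivAt.2⟩
  exact h.mfderiv

theorem mder_comp_eq_id {f : M → M'} {g : M' → M} {x : M} {x' : M'} (hx : f x = x')
    (hg : MDifferentiableAt 𝓘(ℝ, E') 𝓘(ℝ, E) g x') (hf : MDifferentiableAt 𝓘(ℝ, E) 𝓘(ℝ, E') f x)
    (hgf : ∀ᶠ z in 𝓝 x, g (f z) = z) :
    (mder g x' : E' →L[ℝ] E) ∘L mder f x = ContinuousLinearMap.id ℝ E := by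
  rw [← mder_comp_of_eq hx hg hf]
  exact (mder_congr hgf).trans mfderiv_id

theorem isInvertible_mder {f : M → M'} {g : M' → M} {x : M}
    (hf : MDifferentiableAt 𝓘(ℝ, E) 𝓘(ℝ, E') f x)
    (hg : MDifferentiableAt 𝓘(ℝ, E') 𝓘(ℝ, E) g (f x))
    (hgf : ∀ᶠ z in 𝓝 x, g (f z) = z) (hfg : ∀ᶠ z in 𝓝 (f x), f (g z) = z) :
    (mder f x : E →L[ℝ] E').IsInvertible := by
  have hx : g (f x) = x := hgf.self_of_nhds
  exact .of_inverse (mder_comp_eq_id hx hf hg hfg) (mder_comp_eq_id rfl hg hf hgf)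

theorem eventually_mdifferentiableAt [IsManifold 𝓘(ℝ, E) 1 M] [IsManifold 𝓘(ℝ, E') 1 M']
    {f : M → M'} {x : M} (hf : ContMDiffAt 𝓘(ℝ, E) 𝓘(ℝ, E') 1 f x) :
    ∀ᶠ z in 𝓝 x, MDifferentiableAt 𝓘(ℝ, E) 𝓘(ℝ, E') f z :=
  ((contMDiffAt_iff_contMDiffAt_nhds (by simp)).1 hf).mono fun _ hz ↦
    hz.mdifferentiableAt one_ne_zero

end ManifoldDerivative

section Charts

variable {E E' : Type*} [NormedAddCommGroup E] [NormedSpace ℝ E]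
  [NormedAddCommGroup E'] [NormedSpace ℝ E']
  {M : Type*} [TopologicalSpace M] [ChartedSpace E M]

theorem tendsto_extChartAt_symm (p : M) :
    Tendsto (extChartAt 𝓘(ℝ, E) p).symm (𝓝 (extChartAt 𝓘(ℝ, E) p p)) (𝓝 p) := by
  simpa [ContinuousAt] using continuousAt_extChartAt_symm (I := 𝓘(ℝ, E)) p

theorem eventually_extChartAt_symm_extChartAt {p x : M}
    (hx : x ∈ (extChartAt 𝓘(ℝ, E) p).source) :
    ∀ᶠ z in 𝓝 x, (extChartAt 𝓘(ℝ, E) p).symm (extChartAt 𝓘(ℝ, E) p z) = z :=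
  eventually_of_mem ((isOpen_extChartAt_source p).mem_nhds hx)
    fun _ ↦ (extChartAt 𝓘(ℝ, E) p).left_inv

theorem eventually_extChartAt_extChartAt_symm {p : M} {y : E}
    (hy : y ∈ (extChartAt 𝓘(ℝ, E) p).target) :
    ∀ᶠ z in 𝓝 y, extChartAt 𝓘(ℝ, E) p ((extChartAt 𝓘(ℝ, E) p).symm z) = z :=
  eventually_of_mem (extChartAt_target_mem_nhds' hy) fun _ ↦ (extChartAt 𝓘(ℝ, E) p).right_inv

section Smooth

variable [IsManifold 𝓘(ℝ, E) ∞ M]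

theorem mdifferentiableAt_extChartAt_of_mem {p x : M} (hx : x ∈ (extChartAt 𝓘(ℝ, E) p).source) :
    MDifferentiableAt 𝓘(ℝ, E) 𝓘(ℝ, E) (extChartAt 𝓘(ℝ, E) p) x :=
  (contMDiffAt_extChartAt' (n := ∞) (by simpa using hx)).mdifferentiableAt (by simp)

theorem contMDiffAt_extChartAt_symm_of_mem {p : M} {y : E}
    (hy : y ∈ (extChartAt 𝓘(ℝ, E) p).target) :
    ContMDiffAt 𝓘(ℝ, E) 𝓘(ℝ, E) ∞ (extChartAt 𝓘(ℝ, E) p).symm y :=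
  (contMDiffOn_extChartAt_symm p).contMDiffAt (extChartAt_target_mem_nhds' hy)

theorem mdifferentiableAt_extChartAt_symm {p : M} {y : E}
    (hy : y ∈ (extChartAt 𝓘(ℝ, E) p).target) :
    MDifferentiableAt 𝓘(ℝ, E) 𝓘(ℝ, E) (extChartAt 𝓘(ℝ, E) p).symm y :=
  (contMDiffAt_extChartAt_symm_of_mem hy).mdifferentiableAt (by simp)

theorem mder_extChartAt_symm_comp {p x : M} (hx : x ∈ (extChartAt 𝓘(ℝ, E) p).source) :
    (mder (extChartAt 𝓘(ℝ, E) p).symm (extChartAt 𝓘(ℝ, E) p x) : E →L[ℝ] E) ∘L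
      mder (extChartAt 𝓘(ℝ, E) p) x = ContinuousLinearMap.id ℝ E :=
  mder_comp_eq_id rfl
    (mdifferentiableAt_extChartAt_symm ((extChartAt 𝓘(ℝ, E) p).map_source hx))
    (mdifferentiableAt_extChartAt_of_mem hx) (eventually_extChartAt_symm_extChartAt hx)

theorem isInvertible_mder_extChartAt_symm {p : M} {y : E}
    (hy : y ∈ (extChartAt 𝓘(ℝ, E) p).target) :
    (mder (extChartAt 𝓘(ℝ, E) p).symm y : E →L[ℝ] E).IsInvertible := by
  have hsource := (extChartAt 𝓘(ℝ, E) p).map_target hy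
  exact isInvertible_mder (mdifferentiableAt_extChartAt_symm hy)
    (mdifferentiableAt_extChartAt_of_mem hsource) (eventually_extChartAt_extChartAt_symm hy)
    (eventually_extChartAt_symm_extChartAt hsource)

theorem contDiffAt_comp_extChartAt_symm {n : WithTop ℕ∞} (hn : n ≤ ∞) {f : M → E'} {p : M}
    (hf : ContMDiffAt 𝓘(ℝ, E) 𝓘(ℝ, E') n f p) :
    ContDiffAt ℝ n (fun y ↦ f ((extChartAt 𝓘(ℝ, E) p).symm y)) (extChartAt 𝓘(ℝ, E) p p) :=
  contMDiffAt_iff_contDiffAt.1 (ContMDiffAt.comp_of_eq hf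
    ((contMDiffAt_extChartAt_symm_of_mem (mem_extChartAt_target p)).of_le hn)
    (extChartAt_to_inv p))

theorem contMDiffAt_comp_extChartAt_iff {f : E → E'} {p : M} :
    ContMDiffAt 𝓘(ℝ, E) 𝓘(ℝ, E') ∞ (fun x ↦ f (extChartAt 𝓘(ℝ, E) p x)) p ↔
      ContDiffAt ℝ ∞ f (extChartAt 𝓘(ℝ, E) p p) where
  mp h := (contDiffAt_comp_extChartAt_symm le_rfl h).congr_of_eventuallyEq
    ((eventually_extChartAt_extChartAt_symm (mem_extChartAt_target p)).mono
      fun _ hy ↦ congrArg f hy.symm)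
  mpr h := h.contMDiffAt.comp p contMDiffAt_extChartAt

theorem eventually_fderiv_comp_extChartAt_symm {f : M → E'} {p : M}
    (hf : ContMDiffAt 𝓘(ℝ, E) 𝓘(ℝ, E') 1 f p) :
    ∀ᶠ y in 𝓝 (extChartAt 𝓘(ℝ, E) p p),
      fderiv ℝ (fun y ↦ f ((extChartAt 𝓘(ℝ, E) p).symm y)) y =
        (mder f ((extChartAt 𝓘(ℝ, E) p).symm y) : E →L[ℝ] E') ∘L
          mder (extChartAt 𝓘(ℝ, E) p).symm y := by
  have : IsManifold 𝓘(ℝ, E) 1 M := IsManifold.of_le (n := ∞) (by simp)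
  filter_upwards [(tendsto_extChartAt_symm p).eventually (eventually_mdifferentiableAt hf),
    extChartAt_target_mem_nhds p] with y hy hyt
  rw [← mder_eq_fderiv, mder_comp_of_eq rfl hy (mdifferentiableAt_extChartAt_symm hyt)]

end Smooth

/-- The field `b` of bilinear forms, read in the preferred chart around `p`. -/
def chartForm (b : M → E →L[ℝ] E →L[ℝ] ℝ) (p : M) (y : E) : E →L[ℝ] E →L[ℝ] ℝ :=
  (b ((extChartAt 𝓘(ℝ, E) p).symm y)).bilinearComp (mder (extChartAt 𝓘(ℝ, E) p).symm y)
    (mder (extChartAt 𝓘(ℝ, E) p).symm y)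

/-- Near `p`, the field `b` of bilinear forms is the pull-back under `Φ` of the field `G'` of
bilinear forms on a vector space. -/
def IsMPullbackAt (Φ : M → E') (b : M → E →L[ℝ] E →L[ℝ] ℝ) (G' : E' → E' →L[ℝ] E' →L[ℝ] ℝ)
    (p : M) : Prop :=
  ∀ᶠ m in 𝓝 p, ∀ v w, b m v w =
    G' (Φ m) ((mder Φ m : E →L[ℝ] E') v) ((mder Φ m : E →L[ℝ] E') w)

variable [IsManifold 𝓘(ℝ, E) ∞ M]

theorem IsMPullbackAt.isPullbackAt {Φ : M → E'} {b : M → E →L[ℝ] E →L[ℝ] ℝ}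
    {G' : E' → E' →L[ℝ] E' →L[ℝ] ℝ} {p : M} (h : IsMPullbackAt Φ b G' p)
    (hΦ : ContMDiffAt 𝓘(ℝ, E) 𝓘(ℝ, E') 1 Φ p) :
    IsPullbackAt (fun y ↦ Φ ((extChartAt 𝓘(ℝ, E) p).symm y)) (chartForm b p) G'
      (extChartAt 𝓘(ℝ, E) p p) := by
  filter_upwards [(tendsto_extChartAt_symm p).eventually h,
    eventually_fderiv_comp_extChartAt_symm hΦ] with y hy hfderiv v w
  rw [hfderiv]
  exact hy _ _

theorem IsMPullbackAt.contDiffAt_chartForm [FiniteDimensional ℝ E] {Φ : M → E'}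
    {b : M → E →L[ℝ] E →L[ℝ] ℝ} {G' : E' → E' →L[ℝ] E' →L[ℝ] ℝ} {p : M}
    (h : IsMPullbackAt Φ b G' p) (hΦ : ContMDiffAt 𝓘(ℝ, E) 𝓘(ℝ, E') ∞ Φ p)
    (hG' : ContDiffAt ℝ ∞ G' (Φ p)) :
    ContDiffAt ℝ ∞ (chartForm b p) (extChartAt 𝓘(ℝ, E) p p) :=
  (h.isPullbackAt (hΦ.of_le (by simp))).contDiffAt (contDiffAt_comp_extChartAt_symm le_rfl hΦ)
    (by rwa [extChartAt_to_inv]) (by simp)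

theorem inCoordinates_bilin_apply {p x : M} (hx : x ∈ (chartAt E p).source)
    (b : TangentSpace 𝓘(ℝ, E) x →L[ℝ] TangentSpace 𝓘(ℝ, E) x →L[ℝ] ℝ) (v w : E) :
    ContinuousLinearMap.inCoordinates E (TangentSpace 𝓘(ℝ, E)) (E →L[ℝ] ℝ)
      (fun x : M ↦ TangentSpace 𝓘(ℝ, E) x →L[ℝ] ℝ) p x p x b v w =
    b ((trivializationAt E (TangentSpace 𝓘(ℝ, E)) p).symmL ℝ x v)
      ((trivializationAt E (TangentSpace 𝓘(ℝ, E)) p).symmL ℝ x w) := by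
  rw [ContinuousLinearMap.inCoordinates, ContinuousLinearMap.comp_apply,
    ContinuousLinearMap.comp_apply, Bundle.Trivialization.continuousLinearMapAt_apply,
    Bundle.Trivialization.linearMapAt_apply, if_pos (by simp [hx]), hom_trivializationAt_apply]
  simp [ContinuousLinearMap.inCoordinates]

theorem symmL_trivializationAt_eq_mder {p x : M} (hx : x ∈ (chartAt E p).source) (v : E) :
    (trivializationAt E (TangentSpace 𝓘(ℝ, E)) p).symmL ℝ x v =
      (mder (extChartAt 𝓘(ℝ, E) p).symm (extChartAt 𝓘(ℝ, E) p x) : E →L[ℝ] E) v := by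
  rw [TangentBundle.symmL_trivializationAt hx, ModelWithCorners.range_eq_univ, mfderivWithin_univ]
  rfl

theorem contMDiffAt_bilin_section_iff (b : M → E →L[ℝ] E →L[ℝ] ℝ) (p : M) :
    ContMDiffAt 𝓘(ℝ, E) (𝓘(ℝ, E).prod 𝓘(ℝ, E →L[ℝ] E →L[ℝ] ℝ)) ∞
      (fun x ↦ Bundle.TotalSpace.mk' (E →L[ℝ] E →L[ℝ] ℝ)
        (E := fun x : M ↦ TangentSpace 𝓘(ℝ, E) x →L[ℝ] TangentSpace 𝓘(ℝ, E) x →L[ℝ] ℝ) x (b x)) p ↔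
    ContDiffAt ℝ ∞ (chartForm b p) (extChartAt 𝓘(ℝ, E) p p) := by
  have hcoord : (fun x ↦ ContinuousLinearMap.inCoordinates E (TangentSpace 𝓘(ℝ, E)) (E →L[ℝ] ℝ)
      (fun x : M ↦ TangentSpace 𝓘(ℝ, E) x →L[ℝ] ℝ) p x p x (b x)) =ᶠ[𝓝 p]
      fun x ↦ chartForm b p (extChartAt 𝓘(ℝ, E) p x) := by
    filter_upwards [chart_source_mem_nhds E p,
      eventually_extChartAt_symm_extChartAt (E := E) (mem_extChartAt_source p)] with x hx hleft
    ext v w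
    refine (inCoordinates_bilin_apply hx (b x) v w).trans ?_
    rw [symmL_trivializationAt_eq_mder hx, symmL_trivializationAt_eq_mder hx, chartForm, hleft]
    rfl
  rw [contMDiffAt_hom_bundle, ← contMDiffAt_comp_extChartAt_iff]
  exact ⟨fun h ↦ h.2.congr_of_eventuallyEq hcoord.symm,
    fun h ↦ ⟨contMDiffAt_id, h.congr_of_eventuallyEq hcoord⟩⟩

end Charts

section RiemannianMetric

variable {E E' : Type*} [NormedAddCommGroup E] [NormedSpace ℝ E]
  [NormedAddCommGroup E'] [NormedSpace ℝ E']
  {M : Type*} [TopologicalSpace M] [ChartedSpace E M] [IsManifold 𝓘(ℝ, E) ∞ M]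

/-- A Riemannian metric, seen as a family of bilinear forms on the model space. -/
def metricForm (g : RiemMetric E M) (x : M) : E →L[ℝ] E →L[ℝ] ℝ := g.inner x

theorem isInnerForm_metricForm (g : RiemMetric E M) (x : M) : IsInnerForm (metricForm g x) where
  symm := g.symm x
  pos := g.pos x

theorem chartMetric_eq_chartForm (g : RiemMetric E M) (p : M) :
    chartMetric g p = chartForm (metricForm g) p := rfl

theorem ricci_eq (g : RiemMetric E M) (p : M) (v w : E) :
    ricci g p v w = coordRicci (chartMetric g p) (extChartAt 𝓘(ℝ, E) p p)
      (mder (extChartAt 𝓘(ℝ, E) p) p v) (mder (extChartAt 𝓘(ℝ, E) p) p w) := rfl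

theorem metricForm_eq_chartMetric (g : RiemMetric E M) {p x : M}
    (hx : x ∈ (extChartAt 𝓘(ℝ, E) p).source) (v w : E) :
    metricForm g x v w = chartMetric g p (extChartAt 𝓘(ℝ, E) p x)
      ((mder (extChartAt 𝓘(ℝ, E) p) x : E →L[ℝ] E) v)
      ((mder (extChartAt 𝓘(ℝ, E) p) x : E →L[ℝ] E) w) := by
  have hid (u : E) : (mder (extChartAt 𝓘(ℝ, E) p).symm (extChartAt 𝓘(ℝ, E) p x) : E →L[ℝ] E)
      ((mder (extChartAt 𝓘(ℝ, E) p) x : E →L[ℝ] E) u) = u :=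
    DFunLike.congr_fun (mder_extChartAt_symm_comp hx) u
  rw [chartMetric_eq_chartForm, chartForm, ContinuousLinearMap.bilinearComp_apply, hid, hid,
    (extChartAt 𝓘(ℝ, E) p).left_inv hx]

theorem isInnerForm_chartMetric (g : RiemMetric E M) {p : M} {y : E}
    (hy : y ∈ (extChartAt 𝓘(ℝ, E) p).target) : IsInnerForm (chartMetric g p y) :=
  (isInnerForm_metricForm g _).bilinearComp (isInvertible_mder_extChartAt_symm hy).injective

theorem contDiffAt_chartMetric (g : RiemMetric E M) (p : M) :
    ContDiffAt ℝ ∞ (chartMetric g p) (extChartAt 𝓘(ℝ, E) p p) :=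
  (contMDiffAt_bilin_section_iff (metricForm g) p).1 (g.contMDiff p)

theorem IsInnerForm.isCoercive [FiniteDimensional ℝ E] {b : E →L[ℝ] E →L[ℝ] ℝ}
    (hb : IsInnerForm b) : IsCoercive b := by
  rcases subsingleton_or_nontrivial E with hE | hE
  · exact ⟨1, one_pos, fun v ↦ by simp [Subsingleton.elim v 0]⟩
  obtain ⟨v₀, hv₀, hmin⟩ := (isCompact_sphere (0 : E) 1).exists_isMinOn
    (NormedSpace.sphere_nonempty.2 zero_le_one)
    (by fun_prop : Continuous fun v ↦ b v v).continuousOn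
  refine ⟨b v₀ v₀, hb.pos v₀ (ne_zero_of_mem_unit_sphere ⟨v₀, hv₀⟩), fun v ↦ ?_⟩
  rcases eq_or_ne v 0 with rfl | hv
  · simp
  have hv' : ‖v‖ ≠ 0 := norm_ne_zero_iff.2 hv
  have hunit : ‖v‖⁻¹ • v ∈ Metric.sphere (0 : E) 1 := by simp [norm_smul, hv']
  calc b v₀ v₀ * ‖v‖ * ‖v‖ ≤ b (‖v‖⁻¹ • v) (‖v‖⁻¹ • v) * ‖v‖ * ‖v‖ := by
        gcongr
        exact hmin hunit
    _ = b v v := by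
        simp only [map_smul, smul_apply, smul_eq_mul]
        field_simp

theorem IsInnerForm.isVonNBounded [FiniteDimensional ℝ E] {b : E →L[ℝ] E →L[ℝ] ℝ}
    (hb : IsInnerForm b) : Bornology.IsVonNBounded ℝ {v : E | b v v < 1} := by
  obtain ⟨c, hc, hcoercive⟩ := hb.isCoercive
  rw [NormedSpace.isVonNBounded_iff]
  refine (Metric.isBounded_closedBall (x := (0 : E)) (r := √c⁻¹)).subset fun v hv ↦ ?_
  rw [mem_closedBall_zero_iff]
  refine Real.le_sqrt_of_sq_le ?_
  rw [← one_div, le_div_iff₀ hc]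
  linarith [hcoercive v, hv.out, mul_assoc c ‖v‖ ‖v‖, sq ‖v‖, mul_comm c (‖v‖ * ‖v‖)]

/-- The Riemannian metric defined by a field of inner products which is smooth in charts. -/
def mkMetric [FiniteDimensional ℝ E] (b : M → E →L[ℝ] E →L[ℝ] ℝ) (hin : ∀ m, IsInnerForm (b m))
    (hb : ∀ p : M, ContDiffAt ℝ ∞ (chartForm b p) (extChartAt 𝓘(ℝ, E) p p)) :
    RiemMetric E M where
  inner x := b x
  symm x := (hin x).symm
  pos x := (hin x).pos
  isVonNBounded x := by
    have h := (hin x).isVonNBounded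
    exact h
  contMDiff p := (contMDiffAt_bilin_section_iff b p).2 (hb p)

theorem ricci_eq_of_isMPullbackAt [FiniteDimensional ℝ E] [FiniteDimensional ℝ E']
    (g : RiemMetric E M) {Φ : M → E'} {p : M} {G' : E' → E' →L[ℝ] E' →L[ℝ] ℝ}
    (hΦ : ContMDiffAt 𝓘(ℝ, E) 𝓘(ℝ, E') 3 Φ p) (hi : (mder Φ p : E →L[ℝ] E').IsInvertible)
    (hloc : IsMPullbackAt Φ (metricForm g) G' p) (hG' : ContDiffAt ℝ 2 G' (Φ p))
    (hin : ∀ᶠ z in 𝓝 (Φ p), IsInnerForm (G' z)) (v w : E) :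
    ricci g p v w = coordRicci G' (Φ p) ((mder Φ p : E →L[ℝ] E') v)
      ((mder Φ p : E →L[ℝ] E') w) := by
  have hp : (extChartAt 𝓘(ℝ, E) p).symm (extChartAt 𝓘(ℝ, E) p p) = p := extChartAt_to_inv p
  have hΦ₁ : ContMDiffAt 𝓘(ℝ, E) 𝓘(ℝ, E') 1 Φ p := hΦ.of_le (by norm_num)
  have hfderiv := (eventually_fderiv_comp_extChartAt_symm hΦ₁).self_of_nhds
  rw [hp] at hfderiv
  have hfderiv_apply (v : E) : fderiv ℝ (fun y ↦ Φ ((extChartAt 𝓘(ℝ, E) p).symm y))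
      (extChartAt 𝓘(ℝ, E) p p) ((mder (extChartAt 𝓘(ℝ, E) p) p : E →L[ℝ] E) v) =
        (mder Φ p : E →L[ℝ] E') v := by
    rw [hfderiv]
    exact congrArg _ (DFunLike.congr_fun (mder_extChartAt_symm_comp (mem_extChartAt_source p)) v)
  have hinv := hi.comp (isInvertible_mder_extChartAt_symm (mem_extChartAt_target p))
  rw [← hfderiv] at hinv
  rw [ricci_eq, chartMetric_eq_chartForm, (hloc.isPullbackAt hΦ₁).coordRicci_eq
    (contDiffAt_comp_extChartAt_symm ENat.LEInfty.out hΦ) hinv (by rwa [hp]) (by rwa [hp]),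
    hfderiv_apply, hfderiv_apply, hp]

theorem coordRicci_chartMetric_pos (g : RiemMetric E M) (hg : HasPositiveRicci g) (p : M) (v : E)
    (hv : v ≠ 0) : 0 < coordRicci (chartMetric g p) (extChartAt 𝓘(ℝ, E) p p) v v := by
  let A : E →L[ℝ] E := mder (extChartAt 𝓘(ℝ, E) p).symm (extChartAt 𝓘(ℝ, E) p p)
  have hA : Function.Injective A :=
    (isInvertible_mder_extChartAt_symm (mem_extChartAt_target p)).injective
  have hinv : (mder (extChartAt 𝓘(ℝ, E) p) p : E →L[ℝ] E) (A v) = v :=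
    hA (DFunLike.congr_fun (mder_extChartAt_symm_comp (mem_extChartAt_source p)) (A v))
  have hpos : 0 < ricci g p (A v) (A v) := hg p (A v) ((map_ne_zero_iff A hA).2 hv)
  rwa [ricci_eq, hinv] at hpos

end RiemannianMetric

/-! ### Averages of families of isometries -/

section KillingCombination

variable {E : Type*} [NormedAddCommGroup E] [NormedSpace ℝ E] {κ : Type*} [Fintype κ]

theorem isKillingAt_sum_smul {G : E → E →L[ℝ] E →L[ℝ] ℝ} {ξ : κ → E → E} {r : κ → ℝ} {y : E}
    (hd : ∀ i, r i ≠ 0 → DifferentiableAt ℝ (ξ i) y) (h : ∀ i, r i ≠ 0 → IsKillingAt G (ξ i) y) :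
    IsKillingAt G (fun z ↦ ∑ i, r i • ξ i z) y := by
  have hsum : HasFDerivAt (fun z ↦ ∑ i, r i • ξ i z) (∑ i, r i • fderiv ℝ (ξ i) y) y := by
    refine HasFDerivAt.fun_sum fun i _ ↦ ?_
    by_cases hi : r i = 0
    · simpa [hi] using hasFDerivAt_const (0 : E) y
    · exact (hd i hi).hasFDerivAt.const_smul (r i)
  intro v w
  simp only [hsum.fderiv, map_sum, map_smul, sum_apply, smul_apply]
  rw [← Finset.sum_add_distrib, ← Finset.sum_add_distrib]
  refine Finset.sum_eq_zero fun i _ ↦ ?_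
  by_cases hi : r i = 0
  · simp [hi]
  · rw [← smul_add, ← smul_add, h i hi v w, smul_zero]

end KillingCombination

section Gauge

variable {E E' : Type*} [NormedAddCommGroup E] [NormedSpace ℝ E]
  [NormedAddCommGroup E'] [NormedSpace ℝ E']

/-- `ψ` is, near `y`, a family of isometries of `GF` parametrized by `E` which reduces to the
identity at the parameter `y.1`. -/
structure IsIsometryFamily (GF : E' → E' →L[ℝ] E' →L[ℝ] ℝ) (ψ : E × E' → E') (y : E × E') :
    Prop where
  contDiffAt : ContDiffAt ℝ 2 ψ y
  eq_id : ∀ᶠ f in 𝓝 y.2, ψ (y.1, f) = f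
  isometry : ∀ᶠ z in 𝓝 y, ∀ w w', GF (ψ z) (fderiv ℝ ψ z (0, w)) (fderiv ℝ ψ z (0, w')) =
    GF z.2 w w'

namespace IsIsometryFamily

variable {GF : E' → E' →L[ℝ] E' →L[ℝ] ℝ} {ψ : E × E' → E'} {y : E × E'}

theorem differentiableAt (h : IsIsometryFamily GF ψ y) : DifferentiableAt ℝ ψ y :=
  h.contDiffAt.differentiableAt two_ne_zero

theorem differentiableAt_fderiv (h : IsIsometryFamily GF ψ y) :
    DifferentiableAt ℝ (fderiv ℝ ψ) y :=
  (h.contDiffAt.fderiv_right (m := 1) (by norm_num)).differentiableAt one_ne_zero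

theorem fderiv_vert (h : IsIsometryFamily GF ψ y) (w : E') : fderiv ℝ ψ y (0, w) = w := by
  rw [← fderiv_comp_prodMk_right h.differentiableAt, EventuallyEq.fderiv_eq (𝕜 := ℝ) h.eq_id,
    fderiv_fun_id, ContinuousLinearMap.id_apply]

theorem isKillingAt_velocity (h : IsIsometryFamily GF ψ y) (hF : DifferentiableAt ℝ GF y.2)
    (v : E) : IsKillingAt GF (fun f ↦ fderiv ℝ ψ (y.1, f) (v, 0)) y.2 := by
  intro w w'
  have hψy : ψ y = y.2 := h.eq_id.self_of_nhds
  have dF : DifferentiableAt ℝ GF (ψ y) := by rwa [hψy]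
  have dF_snd : DifferentiableAt ℝ (fun z : E × E' ↦ GF z.2) y := hF.comp y differentiableAt_snd
  have dψ := h.differentiableAt
  have dψ' := h.differentiableAt_fderiv
  have symm := h.contDiffAt.isSymmSndFDerivAt (by simp)
  have hvelocity (w : E') : fderiv ℝ (fun f ↦ fderiv ℝ ψ (y.1, f) (v, 0)) y.2 w =
      fderiv ℝ (fderiv ℝ ψ) y (v, 0) (0, w) := by
    rw [fderiv_comp_prodMk_right (g := fun z ↦ fderiv ℝ ψ z (v, 0)) (by fun_prop),
      fderiv_clm_apply_const dψ', symm.eq]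
  have hisometry := DFunLike.congr_fun (EventuallyEq.fderiv_eq (𝕜 := ℝ)
    (h.isometry.mono fun z hz ↦ hz w w')) ((v, 0) : E × E')
  rw [fderiv_bilin_apply_apply (A := fun z ↦ GF (ψ z)) (dF.comp y dψ) (by fun_prop)
    (by fun_prop), fderiv_fun_comp y dF dψ, fderiv_clm_apply_const dψ',
    fderiv_clm_apply_const dψ', fderiv_bilin_apply_const dF_snd,
    fderiv_fun_comp y hF differentiableAt_snd, fderiv_snd] at hisometry
  simpa [hvelocity, h.fderiv_vert, hψy] using hisometry

end IsIsometryFamily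

variable {κ : Type*} [Fintype κ]

/-- The connection form obtained by averaging, with weights `r`, the velocities of the families of
isometries `ψ i`. The family may depend on the point of the base at which the form is computed:
`ψ i b` is the one used over `b`. -/
def gaugeForm (ψ : κ → E → E × E' → E') (r : κ → E → ℝ) (y : E × E') : E →L[ℝ] E' :=
  ∑ i, r i y.1 • (fderiv ℝ (ψ i y.1) y ∘L ContinuousLinearMap.inl ℝ E E')

theorem gaugeForm_apply (ψ : κ → E → E × E' → E') (r : κ → E → ℝ) (y : E × E') (v : E) :
    gaugeForm ψ r y v = ∑ i, r i y.1 • fderiv ℝ (ψ i y.1) y (v, 0) := by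
  simp [gaugeForm, sum_apply]

variable {GF : E' → E' →L[ℝ] E' →L[ℝ] ℝ} {ψ : κ → E → E × E' → E'} {r : κ → E → ℝ} {y : E × E'}

theorem contDiffAt_gaugeForm
    (h : ∀ i, (∀ᶠ b in 𝓝 y.1, r i b = 0) ∨
      (ContDiffAt ℝ ∞ (r i) y.1 ∧ ContDiffAt ℝ ∞ (Function.uncurry (ψ i)) (y.1, y))) :
    ContDiffAt ℝ ∞ (gaugeForm ψ r) y := by
  refine ContDiffAt.sum fun i _ ↦ ?_
  rcases h i with hzero | ⟨hr, hψ⟩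
  · refine (contDiffAt_const (c := (0 : E →L[ℝ] E'))).congr_of_eventuallyEq ?_
    filter_upwards [(continuous_fst.tendsto y).eventually hzero] with z hz
    simp [hz]
  · have hfderiv : ContDiffAt ℝ ∞ (fun z : E × E' ↦ fderiv ℝ (ψ i z.1) z) y := by
      refine ContDiffAt.fderiv (f := fun z : E × E' ↦ ψ i z.1) (g := id) (n := ∞) ?_ contDiffAt_id
        (by simp)
      exact ContDiffAt.comp (y, y) (g := Function.uncurry (ψ i))
        (f := fun q : (E × E') × (E × E') ↦ (q.1.1, q.2)) hψ (by fun_prop)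
    exact (hr.comp y contDiffAt_fst).smul (hfderiv.clm_comp contDiffAt_const)

theorem sum_smul_fderiv_eq_vertProj (hr : ∑ i, r i y.1 = 1)
    (h : ∀ i, r i y.1 ≠ 0 → IsIsometryFamily GF (ψ i y.1) y) (X : E × E') :
    ∑ i, r i y.1 • fderiv ℝ (ψ i y.1) y X = vertProj (gaugeForm ψ r) y X := by
  have hsplit (i : κ) : r i y.1 • fderiv ℝ (ψ i y.1) y X =
      r i y.1 • X.2 + r i y.1 • fderiv ℝ (ψ i y.1) y (X.1, 0) := by
    by_cases hi : r i y.1 = 0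
    · simp [hi]
    · calc r i y.1 • fderiv ℝ (ψ i y.1) y X
          = r i y.1 • fderiv ℝ (ψ i y.1) y ((0, X.2) + (X.1, 0)) := by simp
        _ = r i y.1 • X.2 + r i y.1 • fderiv ℝ (ψ i y.1) y (X.1, 0) := by
          rw [map_add, (h i hi).fderiv_vert, smul_add]
  simp only [hsplit, Finset.sum_add_distrib, ← Finset.sum_smul, hr, one_smul, vertProj_apply,
    gaugeForm_apply]

theorem isKillingAt_gaugeForm (hF : DifferentiableAt ℝ GF y.2)
    (h : ∀ i, r i y.1 ≠ 0 → IsIsometryFamily GF (ψ i y.1) y) (v : E) :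
    IsKillingAt GF (fun f ↦ gaugeForm ψ r (y.1, f) v) y.2 := by
  simp only [gaugeForm_apply]
  refine isKillingAt_sum_smul (fun i hi ↦ ?_) fun i hi ↦ (h i hi).isKillingAt_velocity hF v
  have hvelocity := (h i hi).differentiableAt_fderiv.clm_apply
    (differentiableAt_const (v, (0 : E')))
  exact DifferentiableAt.comp (g := fun z ↦ fderiv ℝ (ψ i y.1) z (v, 0)) y.2 hvelocity
    (by fun_prop)

end Gauge

/-! ### The bundle chart and the averaged connection -/

section SmoothAction

variable {E EG F G : Type*} [NormedAddCommGroup E] [NormedSpace ℝ E] [NormedAddCommGroup EG]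
  [NormedSpace ℝ EG] [TopologicalSpace F] [ChartedSpace E F] [TopologicalSpace G]
  [ChartedSpace EG G] [Group G] [MulAction G F]

variable (EG) in
theorem mdifferentiableAt_const_smul [ContMDiffSMul 𝓘(ℝ, EG) 𝓘(ℝ, E) ∞ G F] (a : G) (x : F) :
    MDifferentiableAt 𝓘(ℝ, E) 𝓘(ℝ, E) (fun x : F ↦ a • x) x :=
  (ContMDiffSMul.contMDiff_const_smul (I := 𝓘(ℝ, EG)) (n := ∞) a).mdifferentiableAt (by simp)

end SmoothAction

section InvariantMetric

variable {E F G : Type*} [NormedAddCommGroup E] [NormedSpace ℝ E] [TopologicalSpace F]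
  [ChartedSpace E F] [IsManifold 𝓘(ℝ, E) ∞ F] [Group G] [MulAction G F]

theorem metricForm_smul {g : RiemMetric E F} (hg : IsInvariantMetric G g) (a : G) (x : F)
    (v w : E) :
    metricForm g (a • x) ((mder (fun y : F ↦ a • y) x : E →L[ℝ] E) v)
      ((mder (fun y : F ↦ a • y) x : E →L[ℝ] E) w) = metricForm g x v w := hg a x v w

theorem chartMetric_smul {g : RiemMetric E F} (hg : IsInvariantMetric G g) {a : G} {p : F} {y : E}
    (hy : y ∈ (extChartAt 𝓘(ℝ, E) p).target)
    (hay : a • (extChartAt 𝓘(ℝ, E) p).symm y ∈ (extChartAt 𝓘(ℝ, E) p).source)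
    (ha : MDifferentiableAt 𝓘(ℝ, E) 𝓘(ℝ, E) (fun x : F ↦ a • x) ((extChartAt 𝓘(ℝ, E) p).symm y))
    (w w' : E) :
    chartMetric g p (extChartAt 𝓘(ℝ, E) p (a • (extChartAt 𝓘(ℝ, E) p).symm y))
      (fderiv ℝ (fun f ↦ extChartAt 𝓘(ℝ, E) p (a • (extChartAt 𝓘(ℝ, E) p).symm f)) y w)
      (fderiv ℝ (fun f ↦ extChartAt 𝓘(ℝ, E) p (a • (extChartAt 𝓘(ℝ, E) p).symm f)) y w') =
    chartMetric g p y w w' := by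
  have hsymm := mdifferentiableAt_extChartAt_symm hy
  rw [← mder_eq_fderiv, mder_comp_of_eq (g := extChartAt 𝓘(ℝ, E) p) (E' := E)
      (f := fun f ↦ a • (extChartAt 𝓘(ℝ, E) p).symm f) rfl
      (mdifferentiableAt_extChartAt_of_mem hay) (ha.comp y hsymm),
    mder_comp_of_eq (g := fun x : F ↦ a • x) (E' := E)
      (f := (extChartAt 𝓘(ℝ, E) p).symm) rfl ha hsymm,
    ContinuousLinearMap.comp_apply, ContinuousLinearMap.comp_apply, ContinuousLinearMap.comp_apply,
    ContinuousLinearMap.comp_apply, ← metricForm_eq_chartMetric g hay, metricForm_smul hg]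
  rfl

end InvariantMetric

namespace FiberBundleWithGroup

variable {EM EB EF EG : Type*}
  [NormedAddCommGroup EM] [NormedSpace ℝ EM] [NormedAddCommGroup EB] [NormedSpace ℝ EB]
  [NormedAddCommGroup EF] [NormedSpace ℝ EF] [NormedAddCommGroup EG] [NormedSpace ℝ EG]
  {M B F G ι : Type*}
  [TopologicalSpace M] [ChartedSpace EM M] [TopologicalSpace B] [ChartedSpace EB B]
  [TopologicalSpace F] [ChartedSpace EF F] [TopologicalSpace G] [ChartedSpace EG G]
  [Group G] [MulAction G F]
  {π : M → B}

section Trivializations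

theorem contMDiffAt_triv (H : FiberBundleWithGroup EM EB EF EG F G ι π) {i : ι} {m : M}
    (hi : π m ∈ (H.triv i).baseSet) :
    ContMDiffAt 𝓘(ℝ, EM) (𝓘(ℝ, EB).prod 𝓘(ℝ, EF)) ∞ (H.triv i) m :=
  (H.contMDiffOn_triv i).contMDiffAt
    ((H.triv i).open_source.mem_nhds ((H.triv i).mem_source.2 hi))

theorem contMDiff_proj (H : FiberBundleWithGroup EM EB EF EG F G ι π) :
    ContMDiff 𝓘(ℝ, EM) 𝓘(ℝ, EB) ∞ π := by
  intro m
  obtain ⟨i, hi⟩ := H.cover (π m)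
  refine (contMDiffAt_fst.comp m (H.contMDiffAt_triv hi)).congr_of_eventuallyEq ?_
  filter_upwards [(H.triv i).open_source.mem_nhds ((H.triv i).mem_source.2 hi)] with x hx
  exact ((H.triv i).coe_fst hx).symm

theorem eventually_proj_mem_source (H : FiberBundleWithGroup EM EB EF EG F G ι π) {b : B}
    {m : M} (hm : π m ∈ (extChartAt 𝓘(ℝ, EB) b).source) :
    ∀ᶠ m' in 𝓝 m, π m' ∈ (extChartAt 𝓘(ℝ, EB) b).source :=
  (H.contMDiff_proj.continuous.tendsto m).eventually ((isOpen_extChartAt_source b).mem_nhds hm)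

theorem surjective_proj (H : FiberBundleWithGroup EM EB EF EG F G ι π) [Nonempty M] :
    Function.Surjective π := by
  intro b
  obtain ⟨m⟩ := ‹Nonempty M›
  obtain ⟨i, hi⟩ := H.cover b
  exact ⟨(H.triv i).toOpenPartialHomeomorph.symm (b, (H.triv i m).2),
    (H.triv i).proj_symm_apply' hi⟩

variable (H : FiberBundleWithGroup EM EB EF EG F G ι π)

/-- The fiber component of a local trivialization. -/
def fiberCoord (i : ι) (m : M) : F := (H.triv i m).2

theorem contMDiffAt_fiberCoord {i : ι} {m : M} (hi : π m ∈ (H.triv i).baseSet) :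
    ContMDiffAt 𝓘(ℝ, EM) 𝓘(ℝ, EF) ∞ (H.fiberCoord i) m :=
  contMDiffAt_snd.comp m (H.contMDiffAt_triv hi)

theorem fiberCoord_change {i j : ι} {m : M} (hi : π m ∈ (H.triv i).baseSet)
    (hj : π m ∈ (H.triv j).baseSet) :
    H.fiberCoord j m = H.transition i j (π m) • H.fiberCoord i m := by
  rw [← H.coordChange_eq i j _ ⟨hi, hj⟩]
  exact ((H.triv i).coordChange_apply_snd (H.triv j) hi).symm

theorem transition_mul_transition {i j : ι} {b : B} (hi : b ∈ (H.triv i).baseSet)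
    (hj : b ∈ (H.triv j).baseSet) : H.transition i j b * H.transition j i b = 1 := by
  have hself : H.transition j j b * H.transition j j b = H.transition j j b :=
    H.cocycle j j j b ⟨⟨hj, hj⟩, hj⟩
  rw [H.cocycle j i j b ⟨⟨hj, hi⟩, hj⟩]
  exact mul_eq_left.1 hself

theorem contMDiffAt_transition {i j : ι} {b : B} (hi : b ∈ (H.triv i).baseSet)
    (hj : b ∈ (H.triv j).baseSet) : ContMDiffAt 𝓘(ℝ, EB) 𝓘(ℝ, EG) ∞ (H.transition i j) b :=
  (H.contMDiffOn_transition i j).contMDiffAt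
    (inter_mem ((H.triv i).open_baseSet.mem_nhds hi) ((H.triv j).open_baseSet.mem_nhds hj))

theorem eventually_mem_baseSet {i : ι} {m : M} (hi : π m ∈ (H.triv i).baseSet) :
    ∀ᶠ m' in 𝓝 m, π m' ∈ (H.triv i).baseSet :=
  (H.contMDiff_proj.continuous.tendsto m).eventually ((H.triv i).open_baseSet.mem_nhds hi)

end Trivializations

section Connection

variable (H : FiberBundleWithGroup EM EB EF EG F G ι π)
  {κ : Type*} [Fintype κ] (ρ : κ → B → ℝ) (c : κ → ι)

/-- The vertical projection of the connection obtained by averaging the flat connections of the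
local trivializations `c k` with weights `ρ k`, read in the trivialization `j`. -/
def vertForm (j : ι) (m : M) : EM →L[ℝ] EF :=
  ∑ k, ρ k (π m) • (mder (fun m' ↦ H.transition (c k) j (π m) • H.fiberCoord (c k) m') m :
    EM →L[ℝ] EF)

theorem mdifferentiableAt_smul_fiberCoord [ContMDiffSMul 𝓘(ℝ, EG) 𝓘(ℝ, EF) ∞ G F] (a : G)
    {i : ι} {m : M} (hi : π m ∈ (H.triv i).baseSet) :
    MDifferentiableAt 𝓘(ℝ, EM) 𝓘(ℝ, EF) (fun m' ↦ a • H.fiberCoord i m') m :=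
  (mdifferentiableAt_const_smul EG a _).comp m
    ((H.contMDiffAt_fiberCoord hi).mdifferentiableAt (by simp))

variable {ρ c}

theorem vertForm_change [ContMDiffSMul 𝓘(ℝ, EG) 𝓘(ℝ, EF) ∞ G F] {i j : ι} {m : M}
    (hρ : ∀ k, ρ k (π m) ≠ 0 → π m ∈ (H.triv (c k)).baseSet)
    (hi : π m ∈ (H.triv i).baseSet) (hj : π m ∈ (H.triv j).baseSet) :
    H.vertForm ρ c j m = (mder (fun x : F ↦ H.transition i j (π m) • x) (H.fiberCoord i m) :
      EF →L[ℝ] EF) ∘L H.vertForm ρ c i m := by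
  refine ContinuousLinearMap.ext fun v ↦ ?_
  simp only [vertForm, sum_apply, ContinuousLinearMap.comp_apply, map_sum, smul_apply, map_smul]
  refine Finset.sum_congr rfl fun k _ ↦ ?_
  by_cases hρk : ρ k (π m) = 0
  · simp [hρk]
  have hk := hρ k hρk
  have hcocycle : (fun m' ↦ H.transition (c k) j (π m) • H.fiberCoord (c k) m') =
      fun m' ↦ H.transition i j (π m) • (H.transition (c k) i (π m) • H.fiberCoord (c k) m') := by
    funext m'
    rw [smul_smul, H.cocycle _ _ _ _ ⟨⟨hk, hi⟩, hj⟩]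
  rw [hcocycle, mder_comp_of_eq (g := fun x : F ↦ H.transition i j (π m) • x)
    (f := fun m' ↦ H.transition (c k) i (π m) • H.fiberCoord (c k) m')
    (H.fiberCoord_change hk hi).symm (mdifferentiableAt_const_smul EG _ _)
    (H.mdifferentiableAt_smul_fiberCoord _ hk)]
  rfl

variable [IsManifold 𝓘(ℝ, EB) ∞ B] [IsManifold 𝓘(ℝ, EF) ∞ F]

variable (ρ c) in
/-- The connection metric on the total space with fibers scaled by `s`, computed in the
trivialization `j`. -/
def connForm (gB : RiemMetric EB B) (gF : RiemMetric EF F) (s : ℝ) (j : ι) (m : M) :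
    EM →L[ℝ] EM →L[ℝ] ℝ :=
  (metricForm gB (π m)).bilinearComp (mder π m : EM →L[ℝ] EB) (mder π m : EM →L[ℝ] EB)
    + s • (metricForm gF (H.fiberCoord j m)).bilinearComp (H.vertForm ρ c j m) (H.vertForm ρ c j m)

theorem connForm_apply (gB : RiemMetric EB B) (gF : RiemMetric EF F) (s : ℝ) (j : ι) (m : M)
    (v w : EM) :
    H.connForm ρ c gB gF s j m v w =
      metricForm gB (π m) ((mder π m : EM →L[ℝ] EB) v) ((mder π m : EM →L[ℝ] EB) w)
      + s * metricForm gF (H.fiberCoord j m) (H.vertForm ρ c j m v) (H.vertForm ρ c j m w) := rfl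

theorem connForm_eq_connForm [ContMDiffSMul 𝓘(ℝ, EG) 𝓘(ℝ, EF) ∞ G F] (gB : RiemMetric EB B)
    {gF : RiemMetric EF F} (hF : IsInvariantMetric G gF) (s : ℝ) {i j : ι} {m : M}
    (hρ : ∀ k, ρ k (π m) ≠ 0 → π m ∈ (H.triv (c k)).baseSet)
    (hi : π m ∈ (H.triv i).baseSet) (hj : π m ∈ (H.triv j).baseSet) :
    H.connForm ρ c gB gF s i m = H.connForm ρ c gB gF s j m := by
  refine ContinuousLinearMap.ext fun v ↦ ContinuousLinearMap.ext fun w ↦ ?_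
  rw [connForm_apply, connForm_apply, H.vertForm_change hρ hi hj, H.fiberCoord_change hi hj,
    ContinuousLinearMap.comp_apply, ContinuousLinearMap.comp_apply, metricForm_smul hF]

end Connection

section BundleChart

variable (H : FiberBundleWithGroup EM EB EF EG F G ι π)

/-- The chart of the total space around `m₀` induced by the trivialization `j` and the preferred
charts of the base and of the fiber. -/
def trivChart (j : ι) (m₀ m : M) : EB × EF :=
  (extChartAt 𝓘(ℝ, EB) (π m₀) (π m),
    extChartAt 𝓘(ℝ, EF) (H.fiberCoord j m₀) (H.fiberCoord j m))

/-- The inverse of `trivChart`. -/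
def trivChartSymm (j : ι) (m₀ : M) (y : EB × EF) : M :=
  (H.triv j).toOpenPartialHomeomorph.symm ((extChartAt 𝓘(ℝ, EB) (π m₀)).symm y.1,
    (extChartAt 𝓘(ℝ, EF) (H.fiberCoord j m₀)).symm y.2)

variable {j : ι} {m₀ : M}

theorem tendsto_extChartAt_symm_fst : Tendsto (fun y : EB × EF ↦
    (extChartAt 𝓘(ℝ, EB) (π m₀)).symm y.1) (𝓝 (H.trivChart j m₀ m₀)) (𝓝 (π m₀)) :=
  (tendsto_extChartAt_symm (π m₀)).comp (continuous_fst.tendsto (H.trivChart j m₀ m₀))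

theorem eventually_extChartAt_symm_fst_mem_baseSet {i : ι} (hi : π m₀ ∈ (H.triv i).baseSet) :
    ∀ᶠ y in 𝓝 (H.trivChart j m₀ m₀),
      (extChartAt 𝓘(ℝ, EB) (π m₀)).symm y.1 ∈ (H.triv i).baseSet :=
  H.tendsto_extChartAt_symm_fst.eventually ((H.triv i).open_baseSet.mem_nhds hi)

theorem eventually_fiberCoord_mem_source {m : M} (hj : π m ∈ (H.triv j).baseSet)
    (hm : H.fiberCoord j m ∈ (extChartAt 𝓘(ℝ, EF) (H.fiberCoord j m₀)).source) :
    ∀ᶠ m' in 𝓝 m, H.fiberCoord j m' ∈ (extChartAt 𝓘(ℝ, EF) (H.fiberCoord j m₀)).source :=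
  (H.contMDiffAt_fiberCoord hj).continuousAt.eventually
    ((isOpen_extChartAt_source (H.fiberCoord j m₀)).mem_nhds hm)

theorem eventually_trivChartSymm_trivChart (hj : π m₀ ∈ (H.triv j).baseSet) :
    ∀ᶠ m in 𝓝 m₀, H.trivChartSymm j m₀ (H.trivChart j m₀ m) = m := by
  filter_upwards [H.eventually_mem_baseSet hj,
    H.eventually_proj_mem_source (mem_extChartAt_source (π m₀)),
    H.eventually_fiberCoord_mem_source hj (mem_extChartAt_source (H.fiberCoord j m₀))]
    with m hmj hmB hmF
  rw [trivChartSymm, trivChart, (extChartAt 𝓘(ℝ, EB) (π m₀)).left_inv hmB,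
    (extChartAt 𝓘(ℝ, EF) (H.fiberCoord j m₀)).left_inv hmF]
  exact (H.triv j).symm_apply_mk_proj ((H.triv j).mem_source.2 hmj)

theorem eventually_trivChart_trivChartSymm (hj : π m₀ ∈ (H.triv j).baseSet) :
    ∀ᶠ y in 𝓝 (H.trivChart j m₀ m₀), H.trivChart j m₀ (H.trivChartSymm j m₀ y) = y := by
  filter_upwards [(continuous_fst.tendsto (H.trivChart j m₀ m₀)).eventually
      (extChartAt_target_mem_nhds (I := 𝓘(ℝ, EB)) (π m₀)),
    (continuous_snd.tendsto (H.trivChart j m₀ m₀)).eventually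
      (extChartAt_target_mem_nhds (I := 𝓘(ℝ, EF)) (H.fiberCoord j m₀)),
    H.eventually_extChartAt_symm_fst_mem_baseSet hj] with y hyB hyF hyj
  have hproj : π (H.trivChartSymm j m₀ y) = (extChartAt 𝓘(ℝ, EB) (π m₀)).symm y.1 :=
    (H.triv j).proj_symm_apply' hyj
  have hfiber : H.fiberCoord j (H.trivChartSymm j m₀ y) =
      (extChartAt 𝓘(ℝ, EF) (H.fiberCoord j m₀)).symm y.2 :=
    congrArg Prod.snd ((H.triv j).apply_symm_apply' hyj)
  rw [trivChart, hproj, hfiber, (extChartAt 𝓘(ℝ, EB) (π m₀)).right_inv hyB,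
    (extChartAt 𝓘(ℝ, EF) (H.fiberCoord j m₀)).right_inv hyF]

theorem contMDiffAt_trivChart (hj : π m₀ ∈ (H.triv j).baseSet) :
    ContMDiffAt 𝓘(ℝ, EM) 𝓘(ℝ, EB × EF) ∞ (H.trivChart j m₀) m₀ :=
  (contMDiffAt_extChartAt.comp m₀ H.contMDiff_proj.contMDiffAt).prodMk_space
    (contMDiffAt_extChartAt.comp m₀ (H.contMDiffAt_fiberCoord hj))

variable [IsManifold 𝓘(ℝ, EB) ∞ B] [IsManifold 𝓘(ℝ, EF) ∞ F]

theorem contMDiffAt_trivChartSymm (hj : π m₀ ∈ (H.triv j).baseSet) :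
    ContMDiffAt 𝓘(ℝ, EB × EF) 𝓘(ℝ, EM) ∞ (H.trivChartSymm j m₀) (H.trivChart j m₀ m₀) := by
  have hB : ContMDiffAt 𝓘(ℝ, EB × EF) 𝓘(ℝ, EB) ∞
      (fun y : EB × EF ↦ (extChartAt 𝓘(ℝ, EB) (π m₀)).symm y.1) (H.trivChart j m₀ m₀) :=
    ContMDiffAt.comp _ (contMDiffAt_extChartAt_symm_of_mem (mem_extChartAt_target (π m₀)))
      contDiffAt_fst.contMDiffAt
  have hF : ContMDiffAt 𝓘(ℝ, EB × EF) 𝓘(ℝ, EF) ∞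
      (fun y : EB × EF ↦ (extChartAt 𝓘(ℝ, EF) (H.fiberCoord j m₀)).symm y.2)
      (H.trivChart j m₀ m₀) :=
    ContMDiffAt.comp _ (contMDiffAt_extChartAt_symm_of_mem
      (mem_extChartAt_target (H.fiberCoord j m₀))) contDiffAt_snd.contMDiffAt
  refine ContMDiffAt.comp _ ((H.contMDiffOn_triv_symm j).contMDiffAt
    ((H.triv j).open_target.mem_nhds ?_)) (hB.prodMk hF)
  rw [(H.triv j).mem_target]
  exact (H.eventually_extChartAt_symm_fst_mem_baseSet hj).self_of_nhds

theorem eventually_isInvertible_mder_trivChart [IsManifold 𝓘(ℝ, EM) ∞ M]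
    (hj : π m₀ ∈ (H.triv j).baseSet) :
    ∀ᶠ m in 𝓝 m₀, (mder (H.trivChart j m₀) m : EM →L[ℝ] EB × EF).IsInvertible := by
  have : IsManifold 𝓘(ℝ, EM) 1 M := IsManifold.of_le (n := ∞) (by simp)
  have hcont := (H.contMDiffAt_trivChart hj).continuousAt
  filter_upwards [(H.eventually_trivChartSymm_trivChart hj).eventually_nhds,
    hcont.eventually (H.eventually_trivChart_trivChartSymm hj).eventually_nhds,
    eventually_mdifferentiableAt ((H.contMDiffAt_trivChart hj).of_le (by simp)),
    hcont.eventually (eventually_mdifferentiableAt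
      ((H.contMDiffAt_trivChartSymm hj).of_le (by simp)))] with m hleft hright hd hd_symm
  exact isInvertible_mder hd hd_symm hleft hright

theorem fst_mder_trivChart {m : M} (hj : π m ∈ (H.triv j).baseSet)
    (hB : π m ∈ (extChartAt 𝓘(ℝ, EB) (π m₀)).source)
    (hF : H.fiberCoord j m ∈ (extChartAt 𝓘(ℝ, EF) (H.fiberCoord j m₀)).source) (v : EM) :
    ((mder (H.trivChart j m₀) m : EM →L[ℝ] EB × EF) v).1 =
      (mder (extChartAt 𝓘(ℝ, EB) (π m₀)) (π m) : EB →L[ℝ] EB) ((mder π m : EM →L[ℝ] EB) v) := by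
  have hπ : MDifferentiableAt 𝓘(ℝ, EM) 𝓘(ℝ, EB) π m :=
    H.contMDiff_proj.contMDiffAt.mdifferentiableAt (by simp)
  have hfiber : MDifferentiableAt 𝓘(ℝ, EM) 𝓘(ℝ, EF) (H.fiberCoord j) m :=
    (H.contMDiffAt_fiberCoord hj).mdifferentiableAt (by simp)
  have hchart := mdifferentiableAt_extChartAt_of_mem hB
  have hprod : (mder (H.trivChart j m₀) m : EM →L[ℝ] EB × EF) = _ := mder_prodMk
    (hchart.comp m hπ) ((mdifferentiableAt_extChartAt_of_mem hF).comp m hfiber)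
  rw [hprod]
  exact DFunLike.congr_fun (mder_comp_of_eq (E'' := EB) (f := π) rfl hchart hπ) v

end BundleChart

section GaugeMap

variable (H : FiberBundleWithGroup EM EB EF EG F G ι π)

/-- The point of the fiber obtained by passing from the trivialization `j` to `i` over the point
`q.2.1` of the base and back over the point `q.1`. -/
def gaugePoint (i j : ι) (m₀ : M) (q : EB × (EB × EF)) : F :=
  H.transition i j ((extChartAt 𝓘(ℝ, EB) (π m₀)).symm q.1) •
    H.transition j i ((extChartAt 𝓘(ℝ, EB) (π m₀)).symm q.2.1) •
      (extChartAt 𝓘(ℝ, EF) (H.fiberCoord j m₀)).symm q.2.2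

/-- The map `gaugePoint`, read in a chart of the fiber. -/
def gaugeMap (i j : ι) (m₀ : M) (b : EB) (z : EB × EF) : EF :=
  extChartAt 𝓘(ℝ, EF) (H.fiberCoord j m₀) (H.gaugePoint i j m₀ (b, z))

variable {i j : ι} {m₀ : M}

theorem exists_gaugePoint_eq_smul (b b' : EB) : ∃ a : G, ∀ f : EF,
    H.gaugePoint i j m₀ (b, (b', f)) = a • (extChartAt 𝓘(ℝ, EF) (H.fiberCoord j m₀)).symm f :=
  ⟨H.transition i j ((extChartAt 𝓘(ℝ, EB) (π m₀)).symm b) *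
    H.transition j i ((extChartAt 𝓘(ℝ, EB) (π m₀)).symm b'), fun _ ↦ smul_smul _ _ _⟩

theorem gaugePoint_self {b : EB}
    (hi : (extChartAt 𝓘(ℝ, EB) (π m₀)).symm b ∈ (H.triv i).baseSet)
    (hj : (extChartAt 𝓘(ℝ, EB) (π m₀)).symm b ∈ (H.triv j).baseSet) (f : EF) :
    H.gaugePoint i j m₀ (b, (b, f)) = (extChartAt 𝓘(ℝ, EF) (H.fiberCoord j m₀)).symm f := by
  rw [gaugePoint, smul_smul, H.transition_mul_transition hi hj, one_smul]

theorem gaugePoint_trivChart (hi : π m₀ ∈ (H.triv i).baseSet) (hj : π m₀ ∈ (H.triv j).baseSet) :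
    H.gaugePoint i j m₀ ((H.trivChart j m₀ m₀).1, H.trivChart j m₀ m₀) = H.fiberCoord j m₀ :=
  (H.gaugePoint_self (H.eventually_extChartAt_symm_fst_mem_baseSet hi).self_of_nhds
    (H.eventually_extChartAt_symm_fst_mem_baseSet hj).self_of_nhds _).trans
    (extChartAt_to_inv (H.fiberCoord j m₀))

variable [IsManifold 𝓘(ℝ, EF) ∞ F] [ContMDiffSMul 𝓘(ℝ, EG) 𝓘(ℝ, EF) ∞ G F]

theorem gaugeMap_isometry {gF : RiemMetric EF F} (hF : IsInvariantMetric G gF) {b : EB}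
    {z : EB × EF} (hd : DifferentiableAt ℝ (H.gaugeMap i j m₀ b) z)
    (ht : z.2 ∈ (extChartAt 𝓘(ℝ, EF) (H.fiberCoord j m₀)).target)
    (hs : H.gaugePoint i j m₀ (b, z) ∈ (extChartAt 𝓘(ℝ, EF) (H.fiberCoord j m₀)).source)
    (w w' : EF) :
    chartMetric gF (H.fiberCoord j m₀) (H.gaugeMap i j m₀ b z)
      (fderiv ℝ (H.gaugeMap i j m₀ b) z (0, w)) (fderiv ℝ (H.gaugeMap i j m₀ b) z (0, w')) =
    chartMetric gF (H.fiberCoord j m₀) z.2 w w' := by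
  obtain ⟨a, ha⟩ := H.exists_gaugePoint_eq_smul (i := i) (j := j) (m₀ := m₀) b z.1
  rw [ha] at hs
  rw [← fderiv_comp_prodMk_right hd, ← fderiv_comp_prodMk_right hd]
  simp only [gaugeMap, ha]
  exact chartMetric_smul hF ht hs (mdifferentiableAt_const_smul EG a _) w w'

variable [IsManifold 𝓘(ℝ, EB) ∞ B]

theorem contMDiffAt_gaugePoint (hi : π m₀ ∈ (H.triv i).baseSet)
    (hj : π m₀ ∈ (H.triv j).baseSet) :
    ContMDiffAt 𝓘(ℝ, EB × (EB × EF)) 𝓘(ℝ, EF) ∞ (H.gaugePoint i j m₀)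
      ((H.trivChart j m₀ m₀).1, H.trivChart j m₀ m₀) := by
  have hb : (extChartAt 𝓘(ℝ, EB) (π m₀)).symm (extChartAt 𝓘(ℝ, EB) (π m₀) (π m₀)) = π m₀ :=
    extChartAt_to_inv (π m₀)
  have hB := contMDiffAt_extChartAt_symm_of_mem (E := EB) (mem_extChartAt_target (π m₀))
  have hF := contMDiffAt_extChartAt_symm_of_mem (E := EF)
    (mem_extChartAt_target (H.fiberCoord j m₀))
  have hij := ContMDiffAt.comp_of_eq (H.contMDiffAt_transition hi hj) (ContMDiffAt.comp
    ((H.trivChart j m₀ m₀).1, H.trivChart j m₀ m₀) hB (contDiffAt_fst.contMDiffAt)) hb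
  have hji := ContMDiffAt.comp_of_eq (H.contMDiffAt_transition hj hi) (ContMDiffAt.comp
    ((H.trivChart j m₀ m₀).1, H.trivChart j m₀ m₀) hB (contDiffAt_snd.fst.contMDiffAt)) hb
  exact hij.smul (hji.smul (ContMDiffAt.comp _ hF contDiffAt_snd.snd.contMDiffAt))

theorem contDiffAt_gaugeMap (hi : π m₀ ∈ (H.triv i).baseSet) (hj : π m₀ ∈ (H.triv j).baseSet) :
    ContDiffAt ℝ ∞ (Function.uncurry (H.gaugeMap i j m₀))
      ((H.trivChart j m₀ m₀).1, H.trivChart j m₀ m₀) :=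
  contMDiffAt_iff_contDiffAt.1 (ContMDiffAt.comp_of_eq contMDiffAt_extChartAt
    (H.contMDiffAt_gaugePoint hi hj) (H.gaugePoint_trivChart hi hj))

theorem eventually_gaugeMap_regular (hi : π m₀ ∈ (H.triv i).baseSet)
    (hj : π m₀ ∈ (H.triv j).baseSet) :
    ∀ᶠ q in 𝓝 ((H.trivChart j m₀ m₀).1, H.trivChart j m₀ m₀),
      ContDiffAt ℝ 2 (H.gaugeMap i j m₀ q.1) q.2 ∧
      q.2.2 ∈ (extChartAt 𝓘(ℝ, EF) (H.fiberCoord j m₀)).target ∧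
      H.gaugePoint i j m₀ q ∈ (extChartAt 𝓘(ℝ, EF) (H.fiberCoord j m₀)).source := by
  have hpoint := (H.contMDiffAt_gaugePoint hi hj).continuousAt
  rw [ContinuousAt, H.gaugePoint_trivChart hi hj] at hpoint
  have hsmooth : ContDiffAt ℝ 2 (Function.uncurry (H.gaugeMap i j m₀))
      ((H.trivChart j m₀ m₀).1, H.trivChart j m₀ m₀) :=
    (H.contDiffAt_gaugeMap hi hj).of_le ENat.LEInfty.out
  filter_upwards [hsmooth.eventually (by simp),
    ((continuous_snd.comp continuous_snd).tendsto
      ((H.trivChart j m₀ m₀).1, H.trivChart j m₀ m₀)).eventually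
        (extChartAt_target_mem_nhds (I := 𝓘(ℝ, EF)) (H.fiberCoord j m₀)),
    hpoint.eventually (extChartAt_source_mem_nhds (I := 𝓘(ℝ, EF)) (H.fiberCoord j m₀))]
    with q hq ht hs
  exact ⟨ContDiffAt.comp q.2 (g := Function.uncurry (H.gaugeMap i j m₀)) (f := fun z ↦ (q.1, z))
    hq (contDiffAt_const.prodMk contDiffAt_id), ht, hs⟩

theorem eventually_isIsometryFamily {gF : RiemMetric EF F} (hF : IsInvariantMetric G gF)
    (hi : π m₀ ∈ (H.triv i).baseSet) (hj : π m₀ ∈ (H.triv j).baseSet) :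
    ∀ᶠ y in 𝓝 (H.trivChart j m₀ m₀),
      IsIsometryFamily (chartMetric gF (H.fiberCoord j m₀)) (H.gaugeMap i j m₀ y.1) y := by
  have hdiag : Tendsto (fun y : EB × EF ↦ (y.1, y)) (𝓝 (H.trivChart j m₀ m₀))
      (𝓝 ((H.trivChart j m₀ m₀).1, H.trivChart j m₀ m₀)) :=
    (continuous_fst.prodMk continuous_id).tendsto _
  filter_upwards [hdiag.eventually (H.eventually_gaugeMap_regular hi hj).eventually_nhds,
    H.eventually_extChartAt_symm_fst_mem_baseSet hi,
    H.eventually_extChartAt_symm_fst_mem_baseSet hj] with y hy hyi hyj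
  obtain ⟨hsmooth, htarget, -⟩ := hy.self_of_nhds
  refine ⟨hsmooth, ?_, ?_⟩
  · filter_upwards [extChartAt_target_mem_nhds' htarget] with f hf
    rw [gaugeMap, H.gaugePoint_self hyi hyj, (extChartAt 𝓘(ℝ, EF) (H.fiberCoord j m₀)).right_inv hf]
  · filter_upwards [((Continuous.prodMk_right y.1).tendsto y).eventually hy]
      with z ⟨hz, hzt, hzs⟩ w w'
    exact H.gaugeMap_isometry hF (hz.differentiableAt two_ne_zero) hzt hzs w w'

end GaugeMap

section AdaptedPartition

variable {κ : Type*} [Fintype κ]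

/-- `ρ` is a finite smooth partition of unity such that `ρ k` is supported in the base set of the
trivialization `c k`. -/
structure IsAdaptedPartition (H : FiberBundleWithGroup EM EB EF EG F G ι π) (ρ : κ → B → ℝ)
    (c : κ → ι) : Prop where
  contMDiff : ∀ k, ContMDiff 𝓘(ℝ, EB) 𝓘(ℝ, ℝ) ∞ (ρ k)
  eventually_zero : ∀ k b, b ∉ (H.triv (c k)).baseSet → ∀ᶠ b' in 𝓝 b, ρ k b' = 0
  sum_eq_one : ∀ b, ∑ k, ρ k b = 1

theorem exists_isAdaptedPartition [IsManifold 𝓘(ℝ, EB) ∞ B] [FiniteDimensional ℝ EB]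
    [CompactSpace B] [T2Space B] (H : FiberBundleWithGroup EM EB EF EG F G ι π) :
    ∃ (t : Finset ι) (ρ : t → B → ℝ), H.IsAdaptedPartition ρ (fun k ↦ (k : ι)) := by
  obtain ⟨t, ht⟩ := isCompact_univ.elim_finite_subcover (fun i ↦ (H.triv i).baseSet)
    (fun i ↦ (H.triv i).open_baseSet) (fun b _ ↦ Set.mem_iUnion.2 (H.cover b))
  have hcover : Set.univ ⊆ ⋃ k : t, (H.triv k).baseSet := fun b hb ↦ by
    obtain ⟨i, hi, hbi⟩ := Set.mem_iUnion₂.1 (ht hb)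
    exact Set.mem_iUnion.2 ⟨⟨i, hi⟩, hbi⟩
  obtain ⟨f, hf⟩ := SmoothPartitionOfUnity.exists_isSubordinate 𝓘(ℝ, EB) isClosed_univ
    (fun k : t ↦ (H.triv k).baseSet) (fun k ↦ (H.triv k).open_baseSet) hcover
  refine ⟨t, fun k b ↦ f k b, fun k ↦ (f k).contMDiff, fun k b hb ↦ ?_, fun b ↦ ?_⟩
  · exact notMem_tsupport_iff_eventuallyEq.1 fun hmem ↦ hb (hf k hmem)
  · rw [← finsum_eq_sum_of_fintype]
    exact f.sum_eq_one (Set.mem_univ b)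

variable {H : FiberBundleWithGroup EM EB EF EG F G ι π} {ρ : κ → B → ℝ} {c : κ → ι}

theorem IsAdaptedPartition.mem_baseSet (hρ : H.IsAdaptedPartition ρ c) (b : B) (k : κ)
    (hk : ρ k b ≠ 0) : b ∈ (H.triv (c k)).baseSet :=
  by_contra fun hb ↦ hk (hρ.eventually_zero k b hb).self_of_nhds

theorem IsAdaptedPartition.eventually_mem_baseSet (hρ : H.IsAdaptedPartition ρ c) (b : B) :
    ∀ᶠ b' in 𝓝 b, ∀ k, ρ k b' ≠ 0 → b ∈ (H.triv (c k)).baseSet := by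
  rw [eventually_all]
  intro k
  by_cases hb : b ∈ (H.triv (c k)).baseSet
  · exact Eventually.of_forall fun _ _ ↦ hb
  · exact (hρ.eventually_zero k b hb).mono fun b' hzero hne ↦ absurd hzero hne

end AdaptedPartition

section LocalForm

variable (H : FiberBundleWithGroup EM EB EF EG F G ι π)
  {κ : Type*} [Fintype κ] (ρ : κ → B → ℝ) (c : κ → ι)

/-- The connection form, in the chart `trivChart`, of the average of the flat connections of the
trivializations `c k`. -/
def localForm (j : ι) (m₀ : M) : EB × EF → EB →L[ℝ] EF :=
  gaugeForm (fun k ↦ H.gaugeMap (c k) j m₀)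
    (fun k b ↦ ρ k ((extChartAt 𝓘(ℝ, EB) (π m₀)).symm b))

variable {ρ c} {j : ι} {m₀ : M} [IsManifold 𝓘(ℝ, EF) ∞ F] [ContMDiffSMul 𝓘(ℝ, EG) 𝓘(ℝ, EF) ∞ G F]

theorem mder_extChartAt_comp_smul_fiberCoord {i : ι} {m : M} (hi : π m ∈ (H.triv i).baseSet)
    (hj : π m ∈ (H.triv j).baseSet) (hB : π m ∈ (extChartAt 𝓘(ℝ, EB) (π m₀)).source)
    (hF : H.fiberCoord j m ∈ (extChartAt 𝓘(ℝ, EF) (H.fiberCoord j m₀)).source)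
    (hd : MDifferentiableAt 𝓘(ℝ, EM) 𝓘(ℝ, EB × EF) (H.trivChart j m₀) m)
    (hg : DifferentiableAt ℝ (H.gaugeMap i j m₀ (H.trivChart j m₀ m).1) (H.trivChart j m₀ m)) :
    (mder (extChartAt 𝓘(ℝ, EF) (H.fiberCoord j m₀)) (H.fiberCoord j m) : EF →L[ℝ] EF) ∘L
      (mder (fun m' ↦ H.transition i j (π m) • H.fiberCoord i m') m : EM →L[ℝ] EF) =
    fderiv ℝ (H.gaugeMap i j m₀ (H.trivChart j m₀ m).1) (H.trivChart j m₀ m) ∘L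
      (mder (H.trivChart j m₀) m : EM →L[ℝ] EB × EF) := by
  rw [← mder_eq_fderiv, ← mder_comp_of_eq (g := extChartAt 𝓘(ℝ, EF) (H.fiberCoord j m₀))
      (f := fun m' ↦ H.transition i j (π m) • H.fiberCoord i m') (E'' := EF)
      (H.fiberCoord_change hi hj).symm (mdifferentiableAt_extChartAt_of_mem hF)
      (H.mdifferentiableAt_smul_fiberCoord _ hi),
    ← mder_comp_of_eq (g := H.gaugeMap i j m₀ (H.trivChart j m₀ m).1) (f := H.trivChart j m₀)
      (E'' := EF) rfl hg.mdifferentiableAt hd]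
  refine mder_congr ?_
  filter_upwards [H.eventually_mem_baseSet hi, H.eventually_mem_baseSet hj,
    H.eventually_proj_mem_source hB, H.eventually_fiberCoord_mem_source hj hF]
    with m' hi' hj' hB' hF'
  simp only [gaugeMap, gaugePoint, trivChart, (extChartAt 𝓘(ℝ, EB) (π m₀)).left_inv hB,
    (extChartAt 𝓘(ℝ, EB) (π m₀)).left_inv hB',
    (extChartAt 𝓘(ℝ, EF) (H.fiberCoord j m₀)).left_inv hF', ← H.fiberCoord_change hj' hi']

theorem vertProj_mder_trivChart {GF : EF → EF →L[ℝ] EF →L[ℝ] ℝ} {m : M}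
    (hρ : H.IsAdaptedPartition ρ c) (hj : π m ∈ (H.triv j).baseSet)
    (hB : π m ∈ (extChartAt 𝓘(ℝ, EB) (π m₀)).source)
    (hF : H.fiberCoord j m ∈ (extChartAt 𝓘(ℝ, EF) (H.fiberCoord j m₀)).source)
    (hd : MDifferentiableAt 𝓘(ℝ, EM) 𝓘(ℝ, EB × EF) (H.trivChart j m₀) m)
    (hiso : ∀ k, ρ k (π m) ≠ 0 → IsIsometryFamily GF
      (H.gaugeMap (c k) j m₀ (H.trivChart j m₀ m).1) (H.trivChart j m₀ m)) (v : EM) :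
    vertProj (H.localForm ρ c j m₀) (H.trivChart j m₀ m)
        ((mder (H.trivChart j m₀) m : EM →L[ℝ] EB × EF) v) =
      (mder (extChartAt 𝓘(ℝ, EF) (H.fiberCoord j m₀)) (H.fiberCoord j m) : EF →L[ℝ] EF)
        (H.vertForm ρ c j m v) := by
  have hb : (extChartAt 𝓘(ℝ, EB) (π m₀)).symm (H.trivChart j m₀ m).1 = π m :=
    (extChartAt 𝓘(ℝ, EB) (π m₀)).left_inv hB
  rw [localForm, ← sum_smul_fderiv_eq_vertProj (by rw [hb]; exact hρ.sum_eq_one _)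
    (by rwa [hb]), hb, vertForm, sum_apply, map_sum]
  refine Finset.sum_congr rfl fun k _ ↦ ?_
  rw [smul_apply, map_smul]
  by_cases hk : ρ k (π m) = 0
  · rw [hk, zero_smul, zero_smul]
  · congr 1
    exact (DFunLike.congr_fun (H.mder_extChartAt_comp_smul_fiberCoord (hρ.mem_baseSet _ k hk) hj hB
      hF hd (hiso k hk).differentiableAt) v).symm

variable [IsManifold 𝓘(ℝ, EB) ∞ B]

theorem contDiffAt_localForm (hρ : H.IsAdaptedPartition ρ c) (hj : π m₀ ∈ (H.triv j).baseSet) :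
    ContDiffAt ℝ ∞ (H.localForm ρ c j m₀) (H.trivChart j m₀ m₀) := by
  refine contDiffAt_gaugeForm fun k ↦ ?_
  by_cases hk : π m₀ ∈ (H.triv (c k)).baseSet
  · exact Or.inr ⟨contDiffAt_comp_extChartAt_symm le_rfl (hρ.contMDiff k).contMDiffAt,
      H.contDiffAt_gaugeMap hk hj⟩
  · exact Or.inl ((tendsto_extChartAt_symm (π m₀)).eventually (hρ.eventually_zero k _ hk))

theorem eventually_forall_isIsometryFamily {gF : RiemMetric EF F} (hF : IsInvariantMetric G gF)
    (hρ : H.IsAdaptedPartition ρ c) (hj : π m₀ ∈ (H.triv j).baseSet) :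
    ∀ᶠ y in 𝓝 (H.trivChart j m₀ m₀), ∀ k, ρ k ((extChartAt 𝓘(ℝ, EB) (π m₀)).symm y.1) ≠ 0 →
      IsIsometryFamily (chartMetric gF (H.fiberCoord j m₀)) (H.gaugeMap (c k) j m₀ y.1) y := by
  have hiso : ∀ᶠ y in 𝓝 (H.trivChart j m₀ m₀), ∀ k, π m₀ ∈ (H.triv (c k)).baseSet →
      IsIsometryFamily (chartMetric gF (H.fiberCoord j m₀)) (H.gaugeMap (c k) j m₀ y.1) y := by
    rw [eventually_all]
    intro k
    by_cases hk : π m₀ ∈ (H.triv (c k)).baseSet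
    · exact (H.eventually_isIsometryFamily hF hk hj).mono fun _ h _ ↦ h
    · exact Eventually.of_forall fun _ h ↦ absurd h hk
  filter_upwards [hiso, H.tendsto_extChartAt_symm_fst.eventually
    (hρ.eventually_mem_baseSet (π m₀))] with y hy hmem k hk
  exact hy k (hmem k hk)

theorem isConnectionData (gB : RiemMetric EB B) {gF : RiemMetric EF F}
    (hF : IsInvariantMetric G gF) (hρ : H.IsAdaptedPartition ρ c)
    (hj : π m₀ ∈ (H.triv j).baseSet) :
    IsConnectionData (chartMetric gB (π m₀)) (chartMetric gF (H.fiberCoord j m₀))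
      (H.localForm ρ c j m₀) (H.trivChart j m₀ m₀) where
  base := (contDiffAt_chartMetric gB (π m₀)).of_le ENat.LEInfty.out
  fiber := (contDiffAt_chartMetric gF (H.fiberCoord j m₀)).of_le ENat.LEInfty.out
  form := (H.contDiffAt_localForm hρ hj).of_le ENat.LEInfty.out
  base_inner := by
    filter_upwards [extChartAt_target_mem_nhds (I := 𝓘(ℝ, EB)) (π m₀)] with b hb
    exact isInnerForm_chartMetric gB hb
  fiber_inner := by
    filter_upwards [extChartAt_target_mem_nhds (I := 𝓘(ℝ, EF)) (H.fiberCoord j m₀)] with f hf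
    exact isInnerForm_chartMetric gF hf
  killing := by
    have hsmooth : ContDiffAt ℝ 1 (chartMetric gF (H.fiberCoord j m₀)) (H.trivChart j m₀ m₀).2 :=
      (contDiffAt_chartMetric gF (H.fiberCoord j m₀)).of_le ENat.LEInfty.out
    filter_upwards [(continuous_snd.tendsto (H.trivChart j m₀ m₀)).eventually
        (hsmooth.eventually (by simp)),
      H.eventually_forall_isIsometryFamily hF hρ hj] with y hy hiso
    exact isKillingAt_gaugeForm (hy.differentiableAt one_ne_zero) hiso

end LocalForm

section TotalMetric

variable (H : FiberBundleWithGroup EM EB EF EG F G ι π)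

/-- A choice, for each point of the base, of a trivialization over a neighborhood of it. -/
def index (b : B) : ι := (H.cover b).choose

theorem mem_baseSet_index (b : B) : b ∈ (H.triv (H.index b)).baseSet := (H.cover b).choose_spec

variable {κ : Type*} [Fintype κ] {ρ : κ → B → ℝ} {c : κ → ι}
  [IsManifold 𝓘(ℝ, EB) ∞ B] [IsManifold 𝓘(ℝ, EF) ∞ F]

variable (ρ c) in
/-- The connection metric on the total space with fibers scaled by `s`, as a field of bilinear
forms. -/
def totalForm (gB : RiemMetric EB B) (gF : RiemMetric EF F) (s : ℝ) (m : M) :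
    EM →L[ℝ] EM →L[ℝ] ℝ :=
  H.connForm ρ c gB gF s (H.index (π m)) m

variable [IsManifold 𝓘(ℝ, EM) ∞ M] [ContMDiffSMul 𝓘(ℝ, EG) 𝓘(ℝ, EF) ∞ G F]
  {j : ι} {m₀ : M} (gB : RiemMetric EB B) {gF : RiemMetric EF F}

theorem eventually_connForm_eq (hF : IsInvariantMetric G gF) (hρ : H.IsAdaptedPartition ρ c)
    (hj : π m₀ ∈ (H.triv j).baseSet) :
    ∀ᶠ m in 𝓝 m₀, ∀ s v w, H.connForm ρ c gB gF s j m v w =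
      connMetric (chartMetric gB (π m₀)) (chartMetric gF (H.fiberCoord j m₀))
        (H.localForm ρ c j m₀) s (H.trivChart j m₀ m)
        ((mder (H.trivChart j m₀) m : EM →L[ℝ] EB × EF) v)
        ((mder (H.trivChart j m₀) m : EM →L[ℝ] EB × EF) w) := by
  have : IsManifold 𝓘(ℝ, EM) 1 M := IsManifold.of_le (n := ∞) (by simp)
  filter_upwards [H.eventually_mem_baseSet hj,
    H.eventually_proj_mem_source (mem_extChartAt_source (π m₀)),
    H.eventually_fiberCoord_mem_source hj (mem_extChartAt_source (H.fiberCoord j m₀)),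
    eventually_mdifferentiableAt ((H.contMDiffAt_trivChart hj).of_le (by simp)),
    (H.contMDiffAt_trivChart hj).continuousAt.eventually
      (H.eventually_forall_isIsometryFamily hF hρ hj)] with m hmj hmB hmF hd hiso s v w
  have hb : (extChartAt 𝓘(ℝ, EB) (π m₀)).symm (H.trivChart j m₀ m).1 = π m :=
    (extChartAt 𝓘(ℝ, EB) (π m₀)).left_inv hmB
  rw [hb] at hiso
  have hvert := H.vertProj_mder_trivChart hρ hmj hmB hmF hd hiso
  simp only [vertProj_apply] at hvert
  rw [connForm_apply, connMetric_apply, hvert, hvert, H.fst_mder_trivChart hmj hmB hmF,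
    H.fst_mder_trivChart hmj hmB hmF, metricForm_eq_chartMetric gB hmB,
    metricForm_eq_chartMetric gF hmF]
  rfl

theorem eventually_totalForm_eq (hF : IsInvariantMetric G gF) (hρ : H.IsAdaptedPartition ρ c)
    (hj : π m₀ ∈ (H.triv j).baseSet) :
    ∀ᶠ m in 𝓝 m₀, ∀ s v w, H.totalForm ρ c gB gF s m v w =
      connMetric (chartMetric gB (π m₀)) (chartMetric gF (H.fiberCoord j m₀))
        (H.localForm ρ c j m₀) s (H.trivChart j m₀ m)
        ((mder (H.trivChart j m₀) m : EM →L[ℝ] EB × EF) v)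
        ((mder (H.trivChart j m₀) m : EM →L[ℝ] EB × EF) w) := by
  filter_upwards [H.eventually_connForm_eq gB hF hρ hj, H.eventually_mem_baseSet hj]
    with m hm hmj s v w
  rw [totalForm, H.connForm_eq_connForm gB hF s (hρ.mem_baseSet (π m))
    (H.mem_baseSet_index (π m)) hmj]
  exact hm s v w

theorem isInnerForm_totalForm (hF : IsInvariantMetric G gF) (hρ : H.IsAdaptedPartition ρ c)
    {s : ℝ} (hs : 0 < s) (m : M) : IsInnerForm (H.totalForm ρ c gB gF s m) := by
  have hj := H.mem_baseSet_index (π m)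
  have hdata := H.isConnectionData gB hF hρ hj
  have hinner := (isInnerForm_connMetric (ξ := H.localForm ρ c (H.index (π m)) m)
    hdata.base_inner.self_of_nhds hdata.fiber_inner.self_of_nhds hs).bilinearComp
    (H.eventually_isInvertible_mder_trivChart hj).self_of_nhds.injective
  have heq : H.totalForm ρ c gB gF s m = (connMetric _ _ _ s _).bilinearComp
      (mder (H.trivChart (H.index (π m)) m) m : EM →L[ℝ] EB × EF)
      (mder (H.trivChart (H.index (π m)) m) m : EM →L[ℝ] EB × EF) :=
    ContinuousLinearMap.ext fun v ↦ ContinuousLinearMap.ext fun w ↦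
      (H.eventually_totalForm_eq gB hF hρ hj).self_of_nhds s v w
  rw [heq]
  exact hinner

variable [FiniteDimensional ℝ EM] [FiniteDimensional ℝ EB] [FiniteDimensional ℝ EF]

/-- The connection metric on the total space, with fibers scaled by `s`. -/
def totalMetric (hF : IsInvariantMetric G gF) (hρ : H.IsAdaptedPartition ρ c) {s : ℝ}
    (hs : 0 < s) : RiemMetric EM M :=
  mkMetric (H.totalForm ρ c gB gF s) (H.isInnerForm_totalForm gB hF hρ hs) fun m ↦
    have hj := H.mem_baseSet_index (π m)
    have hloc : IsMPullbackAt (H.trivChart (H.index (π m)) m) (H.totalForm ρ c gB gF s) _ m :=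
      (H.eventually_totalForm_eq gB hF hρ hj).mono fun _ h ↦ h s
    hloc.contDiffAt_chartForm (H.contMDiffAt_trivChart hj)
      (contDiffAt_connMetric (contDiffAt_chartMetric gB (π m))
        (contDiffAt_chartMetric gF (H.fiberCoord (H.index (π m)) m))
        (H.contDiffAt_localForm hρ hj))

theorem eventually_ricci_totalMetric_eq (hF : IsInvariantMetric G gF)
    (hρ : H.IsAdaptedPartition ρ c) (hj : π m₀ ∈ (H.triv j).baseSet) :
    ∀ᶠ m in 𝓝 m₀, ∀ (s : ℝ) (hs : 0 < s) (v w : EM),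
      ricci (H.totalMetric gB hF hρ hs) m v w =
        coordRicci (connMetric (chartMetric gB (π m₀)) (chartMetric gF (H.fiberCoord j m₀))
          (H.localForm ρ c j m₀) s) (H.trivChart j m₀ m)
          ((mder (H.trivChart j m₀) m : EM →L[ℝ] EB × EF) v)
          ((mder (H.trivChart j m₀) m : EM →L[ℝ] EB × EF) w) := by
  have : IsManifold 𝓘(ℝ, EM) 3 M := IsManifold.of_le (n := ∞) ENat.LEInfty.out
  have hsmooth : ContMDiffAt 𝓘(ℝ, EM) 𝓘(ℝ, EB × EF) 3 (H.trivChart j m₀) m₀ :=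
    (H.contMDiffAt_trivChart hj).of_le ENat.LEInfty.out
  filter_upwards [(H.eventually_totalForm_eq gB hF hρ hj).eventually_nhds,
    H.eventually_isInvertible_mder_trivChart hj,
    (contMDiffAt_iff_contMDiffAt_nhds (by simp)).1 hsmooth,
    (H.contMDiffAt_trivChart hj).continuousAt.eventually
      (H.isConnectionData gB hF hρ hj).eventually] with m hloc hinv hΦ hdata s hs v w
  exact ricci_eq_of_isMPullbackAt (H.totalMetric gB hF hρ hs) hΦ hinv
    (hloc.mono fun _ h ↦ h s)
    ((contDiffAt_connMetric hdata.base hdata.fiber hdata.form).of_le (by norm_num))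
    (hdata.eventually.mono fun z hz ↦ isInnerForm_connMetric hz.base_inner.self_of_nhds
      hz.fiber_inner.self_of_nhds hs) v w

variable {gB}

theorem eventually_ricci_totalMetric_pos (hB : HasPositiveRicci gB)
    (hF : IsInvariantMetric G gF) (hFpos : HasPositiveRicci gF)
    (hρ : H.IsAdaptedPartition ρ c) (m₀ : M) :
    ∀ᶠ p : ℝ × M in 𝓝 (0, m₀), ∀ (hs : 0 < p.1) (v : EM), v ≠ 0 →
      0 < ricci (H.totalMetric gB hF hρ hs) p.2 v v := by
  have hj := H.mem_baseSet_index (π m₀)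
  have hsnd := continuous_snd.tendsto ((0 : ℝ), m₀)
  have hchart : Tendsto (fun p : ℝ × M ↦ (p.1, H.trivChart (H.index (π m₀)) m₀ p.2))
      (𝓝 (0, m₀)) (𝓝 (0, H.trivChart (H.index (π m₀)) m₀ m₀)) :=
    (continuous_fst.tendsto _).prodMk_nhds
      ((H.contMDiffAt_trivChart hj).continuousAt.tendsto.comp hsnd)
  filter_upwards [hchart.eventually (eventually_coordRicci_connMetric_pos
      (H.isConnectionData gB hF hρ hj) (coordRicci_chartMetric_pos gB hB (π m₀))
      (coordRicci_chartMetric_pos gF hFpos _)),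
    hsnd.eventually (H.eventually_ricci_totalMetric_eq gB hF hρ hj),
    hsnd.eventually (H.eventually_isInvertible_mder_trivChart hj)] with p hpos hricci hinv hs v hv
  rw [hricci p.1 hs v v]
  exact hpos hs _ ((map_ne_zero_iff _ hinv.injective).2 hv)

theorem exists_hasPositiveRicci [CompactSpace M] (hB : HasPositiveRicci gB)
    (hF : IsInvariantMetric G gF) (hFpos : HasPositiveRicci gF)
    (hρ : H.IsAdaptedPartition ρ c) : ∃ g : RiemMetric EM M, HasPositiveRicci g := by
  have hsmall : ∀ᶠ s : ℝ in 𝓝 0, ∀ m ∈ (Set.univ : Set M), ∀ (hs : 0 < s) (v : EM), v ≠ 0 →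
      0 < ricci (H.totalMetric gB hF hρ hs) m v v :=
    isCompact_univ.eventually_forall_of_forall_eventually fun m _ ↦
      H.eventually_ricci_totalMetric_pos hB hF hFpos hρ m
  obtain ⟨s, hpos, hs⟩ :=
    ((hsmall.filter_mono nhdsWithin_le_nhds).and (self_mem_nhdsWithin (s := Set.Ioi 0))).exists
  exact ⟨H.totalMetric gB hF hρ hs, fun m ↦ hpos m trivial hs⟩

end TotalMetric

end FiberBundleWithGroup

end PosRicci

end

open PosRicci in
theorem mainTheorem2_general
    {EM EB EF EG : Type*}
    [NormedAddCommGroup EM] [NormedSpace ℝ EM] [FiniteDimensional ℝ EM]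
    [NormedAddCommGroup EB] [NormedSpace ℝ EB] [FiniteDimensional ℝ EB]
    [NormedAddCommGroup EF] [NormedSpace ℝ EF] [FiniteDimensional ℝ EF]
    [NormedAddCommGroup EG] [NormedSpace ℝ EG]
    {M B F G ι : Type*}
    [TopologicalSpace M] [ChartedSpace EM M] [IsManifold 𝓘(ℝ, EM) ∞ M]
    [TopologicalSpace B] [ChartedSpace EB B] [IsManifold 𝓘(ℝ, EB) ∞ B] [T2Space B]
    [TopologicalSpace F] [ChartedSpace EF F] [IsManifold 𝓘(ℝ, EF) ∞ F]
    [TopologicalSpace G] [ChartedSpace EG G] [Group G]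
    [MulAction G F] [ContMDiffSMul 𝓘(ℝ, EG) 𝓘(ℝ, EF) ∞ G F]
    [CompactSpace M]
    (π : M → B) (hbundle : FiberBundleWithGroup EM EB EF EG F G ι π)
    (hB : ∃ gB : RiemMetric EB B, HasPositiveRicci gB)
    (hF : ∃ gF : RiemMetric EF F, IsInvariantMetric G gF ∧ HasPositiveRicci gF) :
    ∃ g : RiemMetric EM M, HasPositiveRicci g := by
  rcases isEmpty_or_nonempty M with hM | hM
  · exact ⟨mkMetric 0 isEmptyElim isEmptyElim, fun m ↦ isEmptyElim m⟩
  obtain ⟨gB, hgB⟩ := hB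
  obtain ⟨gF, hinv, hgF⟩ := hF
  have : CompactSpace B :=
    hbundle.surjective_proj.compactSpace hbundle.contMDiff_proj.continuous
  obtain ⟨t, ρ, hρ⟩ := hbundle.exists_isAdaptedPartition
  exact hbundle.exists_hasPositiveRicci hgB hinv hgF hρ

theorem mainTheorem2
    {EM EB EF EG : Type*}
    [NormedAddCommGroup EM] [NormedSpace ℝ EM] [FiniteDimensional ℝ EM]
    [NormedAddCommGroup EB] [NormedSpace ℝ EB] [FiniteDimensional ℝ EB]
    [NormedAddCommGroup EF] [NormedSpace ℝ EF] [FiniteDimensional ℝ EF]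
    [NormedAddCommGroup EG] [NormedSpace ℝ EG] [FiniteDimensional ℝ EG]
    {M B F G ι : Type*}
    [TopologicalSpace M] [ChartedSpace EM M] [IsManifold 𝓘(ℝ, EM) ∞ M] [T2Space M]
    [TopologicalSpace B] [ChartedSpace EB B] [IsManifold 𝓘(ℝ, EB) ∞ B] [T2Space B]
    [TopologicalSpace F] [ChartedSpace EF F] [IsManifold 𝓘(ℝ, EF) ∞ F] [T2Space F]
    [TopologicalSpace G] [ChartedSpace EG G] [Group G] [LieGroup 𝓘(ℝ, EG) ∞ G]
    [MulAction G F] [ContMDiffSMul 𝓘(ℝ, EG) 𝓘(ℝ, EF) ∞ G F]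
    [CompactSpace M] [ConnectedSpace M]
    (π : M → B) (hbundle : PosRicci.FiberBundleWithGroup EM EB EF EG F G ι π)
    (hB : ∃ gB : PosRicci.RiemMetric EB B, PosRicci.HasPositiveRicci gB)
    (hF : ∃ gF : PosRicci.RiemMetric EF F,
      PosRicci.IsInvariantMetric G gF ∧ PosRicci.HasPositiveRicci gF) :
    ∃ g : PosRicci.RiemMetric EM M, PosRicci.HasPositiveRicci g :=
  mainTheorem2_general π hbundle hB hF
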